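/- For a finite binary string $\sigma$ let $[\sigma]$ be the set of $X\in 2^\omega$ with prefix $\sigma$, and let $\mu$ be the uniform measure on $2^\omega$, so $\mu([\sigma])=2^{-|\sigma|}$. Let $A\in 2^\omega$ be an oracle. An $A$-Martin-Löf test is a non-increasing sequence of uniformly $A$-c.e. open sets $\mathcal U_n=\bigcup_{\sigma\in W_n}[\sigma]$ (the sets $W_n\subseteq 2^{<\omega}$ being uniformly $A$-c.e.) with $\mu(\mathcal U_n)\le 2^{-n}$ for all $n\in\mathbb N$. A sequence $X\in 2^\omega$ is $A$-Martin-Löf random if $X\notin\bigcap_n\mathcal U_n$ for every $A$-Martin-Löf test $(\mathcal U_n)_{n\in\mathbb N}$; the set of these $X$ is denoted $\mathrm{MLR}^A$. A martingale is a function $d:2^{<\omega}\to\mathbb R^{\ge 0}$ with $d(\sigma)=\frac{d(\sigma 0)+d(\sigma 1)}2$ for all $\sigma$; it succeeds on $X$ if $\limsup_n d(X\upharpoonright n)=+\infty$. A sequence $X$ is $A$-computably random if no $A$-computable (as a real-valued function) martingale succeeds on $X$; the set of these $X$ is denoted $\mathrm{CR}^A$. Write $\mathrm{MLR}$ and $\mathrm{CR}$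 for the unrelativized classes (no oracle). Let $$\mathrm{Low}(\mathrm{MLR})=\{A\in 2^\omega : \mathrm{MLR}^A=\mathrm{MLR}\},\qquad \mathrm{Low}(\mathrm{MLR},\mathrm{CR})=\{A\in 2^\omega : \mathrm{MLR}\subseteq \mathrm{CR}^A\}.$$ **Theorem.** The classes $\mathrm{Low}(\mathrm{MLR})$ and $\mathrm{Low}(\mathrm{MLR},\mathrm{CR})$ coincide. -/

import Mathlib

open scoped NNReal ENNReal

namespace AlgRandom

/-- Cantor space `2^ω`: infinite binary sequences. -/
abbrev Cantor : Type := ℕ → Bool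

/-- The initial segment `X(0) X(1) ... X(n-1)` of length `n` of the sequence `X`. -/
def initSeg (X : Cantor) (n : ℕ) : List Bool := List.ofFn fun i : Fin n => X i

/-- The cylinder `[σ]`: all infinite sequences that begin with the string `σ`. -/
def cylinder (σ : List Bool) : Set Cantor := {X | initSeg X σ.length = σ}

/-- The open set `[W]` generated by a set `W` of strings. -/
def openGenerated (W : Set (List Bool)) : Set Cantor := ⋃ σ ∈ W, cylinder σ

/-- The uniform (Lebesgue) measure on Cantor space: the law of independent fair coin tosses. -/
noncomputable def uniformMeasure : MeasureTheory.Measure Cantor :=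
  MeasureTheory.Measure.infinitePi fun _ : ℕ => (PMF.uniformOfFintype Bool).toMeasure

/-! Computability is relative to a set `O` of oracles. The oracle `A : Cantor` is the set
`oracle A`, and absence of an oracle is `O = ∅`. -/

/-- The sequence `A` as an oracle: the characteristic function `n ↦ A(n) ∈ {0, 1}`. -/
def oracle (A : Cantor) : Set (ℕ →. ℕ) := {fun n => Part.some (A n).toNat}

/-- A sequence `(W n)` of sets of strings is uniformly c.e. relative to `O`: one `O`-computable
function enumerates, for each `n`, the elements of `W n` (the value `none` enumerates nothing). -/
def UniformlyCE (O : Set (ℕ →. ℕ)) (W : ℕ → Set (List Bool)) : Prop :=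
  ∃ e : ℕ → ℕ → Option (List Bool),
    ComputableIn₂ O e ∧ ∀ n, W n = {σ | ∃ s, e n s = some σ}

/-- A sequence of open sets is uniformly c.e. open relative to `O`. -/
def UniformlyCEOpen (O : Set (ℕ →. ℕ)) (U : ℕ → Set Cantor) : Prop :=
  ∃ W : ℕ → Set (List Bool), UniformlyCE O W ∧ ∀ n, U n = openGenerated (W n)

/-- Martin-Löf tests relative to `O`. -/
structure IsMLTest (O : Set (ℕ →. ℕ)) (U : ℕ → Set Cantor) : Prop where
  ceOpen : UniformlyCEOpen O U
  antitone : Antitone U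
  measure_le : ∀ n, uniformMeasure (U n) ≤ (2 : ℝ≥0∞)⁻¹ ^ n

/-- The sequences that are Martin-Löf random relative to `O`: those that pass every Martin-Löf
test relative to `O`. -/
def MLR (O : Set (ℕ →. ℕ)) : Set Cantor :=
  {X | ∀ U : ℕ → Set Cantor, IsMLTest O U → X ∉ ⋂ n, U n}

/-- Martingales: the fairness condition `d(σ) = (d(σ0) + d(σ1)) / 2`. -/
def IsMartingale (d : List Bool → ℝ≥0) : Prop :=
  ∀ σ, d σ = (d (σ ++ [false]) + d (σ ++ [true])) / 2

/-- A martingale succeeds on `X` if `limsup d(X ↾ n) = +∞`. -/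
def Succeeds (d : List Bool → ℝ≥0) (X : Cantor) : Prop :=
  Filter.limsup (fun n => (d (initSeg X n) : ℝ≥0∞)) Filter.atTop = ⊤

/-- A non-negative real-valued function on strings is computable relative to `O`: some
`O`-computable function gives, on input `σ` and `n`, the numerator of a rational number
`q σ n / 2 ^ n` within distance `2 ^ (-n)` of `d σ`. -/
def ComputableReal (O : Set (ℕ →. ℕ)) (d : List Bool → ℝ≥0) : Prop :=
  ∃ q : List Bool → ℕ → ℕ, ComputableIn₂ O q ∧
    ∀ σ n, |(q σ n : ℝ) / 2 ^ n - (d σ : ℝ)| ≤ (2 : ℝ)⁻¹ ^ n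

/-- The sequences that are computably random relative to `O`: no `O`-computable martingale
succeeds on them. -/
def CR (O : Set (ℕ →. ℕ)) : Set Cantor :=
  {X | ∀ d : List Bool → ℝ≥0, IsMartingale d → ComputableReal O d → ¬ Succeeds d X}

/-- The oracles that are low for the randomness notion `R`: those with `R^A = R`. -/
def Low (R : Set (ℕ →. ℕ) → Set Cantor) : Set Cantor :=
  {A | R (oracle A) = R ∅}

/-- The oracles that are low for the pair `(R, S)`: those with `R ⊆ S^A`. -/
def LowPair (R S : Set (ℕ →. ℕ) → Set Cantor) : Set Cantor :=
  {A | R ∅ ⊆ S (oracle A)}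

end AlgRandom

/-! One inclusion is Ville's inequality: an `O`-computable martingale that succeeds on a sequence
gives an `O`-Martin-Löf test that the sequence fails (`MLR_subset_CR`).

For the other, assume that every random sequence is computably random relative to `A`, and let `X`
fail an `A`-test. Then `X` has infinitely many prefixes in an `A`-computable set of strings of
finite total weight (`exists_solovay_of_notMem_MLR`). It is enough to cover almost all of that set
by a set of finite weight that is c.e. without an oracle, since then `X` is not random
(`notMem_MLR_of_solovay`).

To find the cover, attach to the string with index `i` and length `ℓ i` an event of probability `2 ^
(-ℓ i)`, the events being independent. Betting the weight of each string of the `A`-computable set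
on its event is an `A`-computable martingale, so by assumption a random sequence lies in only
finitely many of these events (`finite_ev_of_mem_CR`). Let `V` be a c.e. open set of measure at most
`1/2` that contains all non-random sequences. By Baire category, on some cylinder `[σ]` not covered
by `V`, almost all of these events lie in `V` up to a null set (`exists_cylinder_ae_disjoint`).

That `V` nearly covers an event within `[σ]` is a c.e. property of the index, and no oracle is
involved. The indices with this property have finite total weight: independent events of infinite
total probability would fill `[σ]`, whereas `V` leaves out part of positive measure
(`summable_covered`). -/

namespace AlgRandom

/-! ### Oracle computability and primitive recursive tools -/

section Computability

variable {O : Set (ℕ →. ℕ)} {α β γ : Type*} [Primcodable α] [Primcodable β] [Primcodable γ]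

theorem computableIn_comp {f : β → γ} {g : α → β} (hf : ComputableIn O f)
    (hg : ComputableIn O g) : ComputableIn O fun a => f (g a) :=
  (Nat.RecursiveIn.comp hf hg).of_eq fun n => by
    rcases e : Encodable.decode (α := α) n with - | a <;> simp [Encodable.encodek]

theorem computableIn_pair {f : α → β} {g : α → γ} (hf : ComputableIn O f)
    (hg : ComputableIn O g) : ComputableIn O fun a => (f a, g a) :=
  (Nat.RecursiveIn.pair hf hg).of_eq fun n => by
    rcases e : Encodable.decode (α := α) n with - | a <;> simp [Seq.seq]

theorem primrec_comp_computableIn {f : β → γ} {g : α → β} (hf : Primrec f)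
    (hg : ComputableIn O g) : ComputableIn O fun a => f (g a) :=
  computableIn_comp hf.computableIn hg

theorem computableIn_comp_primrec {f : β → γ} {g : α → β} (hf : ComputableIn O f)
    (hg : Primrec g) : ComputableIn O fun a => f (g a) :=
  computableIn_comp hf hg.computableIn

/-- The only recursion performed relative to the oracle. Later algorithms first tabulate finitely
many oracle-dependent values and then apply a primitive recursive function to the table. -/
theorem computableIn_map_range {g : ℕ → β} (hg : ComputableIn O g) :
    ComputableIn O fun n => (List.range n).map g := by
  have h1 : ComputableIn O fun p : ℕ × List β => p.2 ++ [g p.1] :=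
    primrec_comp_computableIn (g := fun p : ℕ × List β => (p.2, g p.1))
      (f := fun q : List β × β => q.1 ++ [q.2])
      (Primrec.list_append.comp Primrec.fst
        (Primrec.list_cons.comp Primrec.snd (Primrec.const [])))
      (computableIn_pair (ComputableIn.snd) (computableIn_comp_primrec hg Primrec.fst))
  have h2 : Nat.RecursiveIn O fun n => Part.bind (Part.ofOption (Encodable.decode (α := ℕ × List β) n))
      fun a : ℕ × List β => (Part.some (a.2 ++ [g a.1])).map Encodable.encode := h1
  have h0 : Nat.RecursiveIn O fun _ => Part.some (Encodable.encode ([] : List β)) :=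
    Nat.Primrec.recursiveIn (Nat.Primrec.const _)
  have h3 := Nat.RecursiveIn.prec h0 (h2.comp Nat.RecursiveIn.right)
  have h4 : Nat.RecursiveIn O fun n => Part.some (Nat.pair 0 n) :=
    Nat.Primrec.recursiveIn ((Nat.Primrec.const 0).pair Nat.Primrec.id)
  refine (h3.comp h4).of_eq fun n => ?_
  simp only [Part.bind_eq_bind, Part.bind_some, Nat.unpair_pair, Encodable.decode_nat,
    Part.coe_some, Part.map_some]
  induction n with
  | zero => rfl
  | succ n ih =>
    refine (congrArg (fun p : Part ℕ => p.bind _) ih).trans ?_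
    simp [List.range_succ, Encodable.encodek]

theorem primrec_sum_range {f : α → ℕ → ℕ} {n : α → ℕ} (hf : Primrec₂ f) (hn : Primrec n) :
    Primrec fun a => ∑ i ∈ Finset.range (n a), f a i := by
  refine (Primrec.nat_rec' (f := n) (g := fun _ : α => 0) (h := fun a p => p.2 + f a p.1) hn
    (Primrec.const 0) (Primrec.nat_add.comp (Primrec.snd.comp Primrec.snd)
      (hf.comp Primrec.fst (Primrec.fst.comp Primrec.snd)))).of_eq fun a => ?_
  induction n a with
  | zero => rfl
  | succ k ih => rw [Finset.sum_range_succ, ← ih]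

theorem primrec_prod_range {f : α → ℕ → ℕ} {n : α → ℕ} (hf : Primrec₂ f) (hn : Primrec n) :
    Primrec fun a => ∏ i ∈ Finset.range (n a), f a i := by
  refine (Primrec.nat_rec' (f := n) (g := fun _ : α => 1) (h := fun a p => p.2 * f a p.1) hn
    (Primrec.const 1) (Primrec.nat_mul.comp (Primrec.snd.comp Primrec.snd)
      (hf.comp Primrec.fst (Primrec.fst.comp Primrec.snd)))).of_eq fun a => ?_
  induction n a with
  | zero => rfl
  | succ k ih => rw [Finset.prod_range_succ, ← ih]

theorem primrec_nat_pow : Primrec₂ ((· ^ ·) : ℕ → ℕ → ℕ) :=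
  Primrec₂.unpaired'.1 Nat.Primrec.pow

theorem primrecPred_exists_lt {p : α → ℕ → Prop} {n : α → ℕ}
    (hp : PrimrecRel p) (hn : Primrec n) : PrimrecPred fun a => ∃ i < n a, p a i := by
  have h := PrimrecRel.exists_mem_list (R := fun (i : ℕ) (a : α) => p a i)
    (hp.comp Primrec.snd Primrec.fst)
  exact (PrimrecRel.comp h (Primrec.list_range.comp hn) Primrec.id).of_eq fun a => by simp

open Classical in
theorem primrec_countP {p : α → β → Prop} {l : α → List β}
    (hp : PrimrecRel p) (hl : Primrec l) :
    Primrec fun a => ((l a).filter fun b => p a b).length := by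
  have h := PrimrecRel.listFilter (R := fun (b : β) (a : α) => p a b)
    (hp.comp Primrec.snd Primrec.fst)
  exact (Primrec.list_length.comp (h.comp hl Primrec.id)).of_eq fun a => rfl

/-- All binary strings of length `n`. -/
def allStrings : ℕ → List (List Bool)
  | 0 => [[]]
  | n + 1 => (allStrings n).flatMap fun σ => [σ ++ [false], σ ++ [true]]

theorem primrec_allStrings : Primrec allStrings := by
  have hh : Primrec₂ fun (_ : ℕ) (p : ℕ × List (List Bool)) =>
      p.2.flatMap fun σ => [σ ++ [false], σ ++ [true]] := by
    refine Primrec.list_flatMap (Primrec.snd.comp Primrec.snd) ?_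
    have : ∀ b : Bool, Primrec fun q : (ℕ × ℕ × List (List Bool)) × List Bool => q.2 ++ [b] :=
      fun b => Primrec.list_append.comp Primrec.snd (Primrec.const [b])
    exact Primrec.list_cons.comp (this false) (Primrec.list_cons.comp (this true) (Primrec.const []))
  refine (Primrec.nat_rec' (f := id) (g := fun _ => [[]]) Primrec.id (Primrec.const _) hh).of_eq
    fun n => ?_
  induction n with
  | zero => rfl
  | succ n ih => rw [allStrings, ← ih]; rfl

theorem mem_allStrings {n : ℕ} {σ : List Bool} : σ ∈ allStrings n ↔ σ.length = n := by
  induction n generalizing σ with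
  | zero => simp [allStrings]
  | succ n ih =>
    simp only [allStrings, List.mem_flatMap, ih, List.mem_cons, List.not_mem_nil, or_false]
    constructor
    · rintro ⟨τ, rfl, rfl | rfl⟩ <;> simp
    · intro h
      have hne : σ ≠ [] := by rintro rfl; simp at h
      refine ⟨σ.dropLast, by simp [h], ?_⟩
      have := List.dropLast_append_getLast hne
      cases hb : σ.getLast hne <;> rw [hb] at this <;> simp [this]

theorem nodup_allStrings (n : ℕ) : (allStrings n).Nodup := by
  induction n with
  | zero => simp [allStrings]
  | succ n ih =>
    rw [allStrings, List.nodup_flatMap]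
    refine ⟨fun σ _ => by simp, ih.imp ?_⟩
    intro σ τ hne
    simp [Function.onFun, hne.symm]

/-- The string with index `i`. -/
def str (i : ℕ) : List Bool := (Encodable.decode i).getD []

theorem primrec_str : Primrec str :=
  Primrec.option_getD.comp Primrec.decode (Primrec.const [])

@[simp] theorem str_encode (σ : List Bool) : str (Encodable.encode σ) = σ := by
  simp [str, Encodable.encodek]

end Computability

/-! ### Cylinders, uniform measure and open sets given by string predicates -/

section CantorSpace

open MeasureTheory

@[simp] theorem length_initSeg (X : Cantor) (n : ℕ) : (initSeg X n).length = n := by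
  simp [initSeg]

theorem getElem?_initSeg (X : Cantor) (n i : ℕ) :
    (initSeg X n)[i]? = if i < n then some (X i) else none := by
  by_cases h : i < n <;> simp [initSeg, h]

theorem initSeg_succ (X : Cantor) (n : ℕ) : initSeg X (n + 1) = initSeg X n ++ [X n] := by
  rw [initSeg, List.ofFn_succ_last]; rfl

theorem take_initSeg (X : Cantor) {m n : ℕ} (h : m ≤ n) :
    (initSeg X n).take m = initSeg X m := by
  refine List.ext_getElem? fun i => ?_
  rw [List.getElem?_take, getElem?_initSeg, getElem?_initSeg]
  split_ifs <;> first | rfl | omega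

theorem dropLast_initSeg (X : Cantor) (n : ℕ) :
    (initSeg X n).dropLast = initSeg X (n - 1) := by
  rw [List.dropLast_eq_take, length_initSeg, take_initSeg X (by omega)]

theorem mem_cylinder {X : Cantor} {σ : List Bool} :
    X ∈ cylinder σ ↔ initSeg X σ.length = σ := Iff.rfl

theorem mem_cylinder_initSeg (X : Cantor) (n : ℕ) : X ∈ cylinder (initSeg X n) := by
  simp [mem_cylinder]

theorem mem_cylinder_iff {X : Cantor} {σ : List Bool} :
    X ∈ cylinder σ ↔ ∀ i ∈ Finset.range σ.length, X i = σ.getD i false := by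
  rw [mem_cylinder]
  constructor
  · intro h i hi
    rw [Finset.mem_range] at hi
    have := getElem?_initSeg X σ.length i
    rw [h, if_pos hi] at this
    simp [List.getD_eq_getElem?_getD, this]
  · intro h
    refine List.ext_getElem? fun i => ?_
    rw [getElem?_initSeg]
    split_ifs with hi
    · rw [h i (Finset.mem_range.2 hi)]
      simp [hi]
    · simp [not_lt.1 hi]

theorem cylinder_eq_pi (σ : List Bool) : cylinder σ =
    Set.pi (Finset.range σ.length : Finset ℕ) fun i => {σ.getD i false} := by
  ext X
  simp [mem_cylinder_iff]

theorem cylinder_eq_initSeg {X Y : Cantor} {n : ℕ} :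
    Y ∈ cylinder (initSeg X n) ↔ initSeg Y n = initSeg X n := by
  simp [mem_cylinder]

theorem isOpen_cylinder (σ : List Bool) : IsOpen (cylinder σ) := by
  rw [cylinder_eq_pi]
  exact isOpen_set_pi (Finset.finite_toSet _) fun _ _ => isOpen_discrete _

theorem measurableSet_cylinder (σ : List Bool) : MeasurableSet (cylinder σ) := by
  rw [cylinder_eq_pi]
  exact MeasurableSet.pi (Finset.countable_toSet _) fun _ _ => MeasurableSet.of_discrete

instance : IsProbabilityMeasure uniformMeasure := by
  unfold uniformMeasure; infer_instance

theorem uniformMeasure_pi (s : Finset ℕ) (b : ℕ → Bool) :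
    uniformMeasure (Set.pi s fun i => {b i}) = (2 : ℝ≥0∞)⁻¹ ^ s.card := by
  rw [uniformMeasure, Measure.infinitePi_pi _ fun _ _ => MeasurableSet.of_discrete]
  simp

theorem uniformMeasure_cylinder (σ : List Bool) :
    uniformMeasure (cylinder σ) = (2 : ℝ≥0∞)⁻¹ ^ σ.length := by
  rw [cylinder_eq_pi, uniformMeasure_pi, Finset.card_range]

open Classical in
theorem uniformMeasure_initSeg_mem (n : ℕ) (p : List Bool → Prop) :
    uniformMeasure {X | p (initSeg X n)} =
      ((allStrings n).filter fun σ => p σ).length * (2 : ℝ≥0∞)⁻¹ ^ n := by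
  have h1 : {X | p (initSeg X n)} =
      ⋃ σ ∈ ((allStrings n).filter fun σ => p σ).toFinset, cylinder σ := by
    ext X
    simp only [Set.mem_ofPred_eq, List.mem_toFinset, List.mem_filter, mem_allStrings,
      decide_eq_true_eq, Set.mem_iUnion, exists_prop]
    constructor
    · intro h
      exact ⟨initSeg X n, ⟨by simp, h⟩, mem_cylinder_initSeg X n⟩
    · rintro ⟨σ, ⟨rfl, h⟩, hX⟩
      rwa [mem_cylinder.1 hX]
  rw [h1, measure_biUnion_finset]
  · rw [Finset.sum_congr rfl (g := fun _ => (2 : ℝ≥0∞)⁻¹ ^ n)]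
    · rw [Finset.sum_const, List.toFinset_card_of_nodup ((nodup_allStrings n).filter _),
        nsmul_eq_mul]
    · intro σ hσ
      rw [List.mem_toFinset, List.mem_filter, mem_allStrings] at hσ
      rw [uniformMeasure_cylinder, hσ.1]
  · intro σ hσ τ hτ hne
    simp only [List.coe_toFinset, Set.mem_ofPred_eq, List.mem_filter, mem_allStrings] at hσ hτ
    refine Set.disjoint_left.2 fun X hX hY => hne ?_
    rw [← mem_cylinder.1 hX, ← mem_cylinder.1 hY, hσ.1, hτ.1]
  · exact fun σ _ => measurableSet_cylinder σ

/-- The open set of all sequences with a prefix satisfying `Q`. -/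
def openOf (Q : List Bool → Prop) : Set Cantor := {X | ∃ n, Q (initSeg X n)}

theorem openOf_eq_openGenerated (Q : List Bool → Prop) : openOf Q = openGenerated {σ | Q σ} := by
  ext X
  simp only [openOf, openGenerated, Set.mem_ofPred_eq, Set.mem_iUnion, exists_prop]
  constructor
  · rintro ⟨n, h⟩
    exact ⟨_, h, mem_cylinder_initSeg X n⟩
  · rintro ⟨σ, h, hX⟩
    exact ⟨σ.length, by rwa [mem_cylinder.1 hX]⟩

theorem isOpen_openOf (Q : List Bool → Prop) : IsOpen (openOf Q) := by
  rw [openOf_eq_openGenerated]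
  exact isOpen_biUnion fun σ _ => isOpen_cylinder σ

theorem measurableSet_openOf (Q : List Bool → Prop) : MeasurableSet (openOf Q) := by
  rw [openOf_eq_openGenerated]
  exact MeasurableSet.biUnion (Set.to_countable _) fun σ _ => measurableSet_cylinder σ

theorem uniformlyCEOpen_openOf {O : Set (ℕ →. ℕ)} {f : ℕ × List Bool → Bool}
    (hf : ComputableIn O f) : UniformlyCEOpen O fun n => openOf fun σ => f (n, σ) = true := by
  refine ⟨fun n => {σ | f (n, σ) = true}, ⟨fun n s => bif f (n, str s) then some (str s) else none,
    ?_, fun n => ?_⟩, fun n => openOf_eq_openGenerated _⟩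
  · have h1 : Primrec fun p : ℕ × ℕ => (p.1, str p.2) :=
      Primrec.pair Primrec.fst (primrec_str.comp Primrec.snd)
    have h2 : Primrec fun q : Bool × List Bool => bif q.1 then some q.2 else none :=
      Primrec.cond Primrec.fst (Primrec.option_some.comp Primrec.snd) (Primrec.const none)
    exact primrec_comp_computableIn (g := fun p : ℕ × ℕ => (f (p.1, str p.2), str p.2)) h2
      (computableIn_pair (computableIn_comp_primrec hf h1)
        (Primrec.computableIn (Primrec.snd.comp h1)))
  · ext σ
    simp only [Set.mem_ofPred_eq]
    constructor
    · intro h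
      exact ⟨Encodable.encode σ, by simp [h]⟩
    · rintro ⟨s, hs⟩
      cases h : f (n, str s) <;> simp [h] at hs
      rw [← hs, h]

/-- A uniform decidable family of string predicates of small measure yields a Martin-Löf test. -/
theorem notMem_MLR_of_openOf {O : Set (ℕ →. ℕ)} {f : ℕ × List Bool → Bool}
    (hf : ComputableIn O f)
    (hanti : Antitone fun n => openOf fun σ => f (n, σ) = true)
    (hμ : ∀ n, uniformMeasure (openOf fun σ => f (n, σ) = true) ≤ (2 : ℝ≥0∞)⁻¹ ^ n)
    {X : Cantor} (hX : ∀ n, ∃ k, f (n, initSeg X k) = true) : X ∉ MLR O := fun h =>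
  h _ ⟨uniformlyCEOpen_openOf hf, hanti, hμ⟩ (Set.mem_iInter.2 hX)

end CantorSpace

/-! ### Ville's inequality; Martin-Löf randomness implies computable randomness -/

section Ville

open MeasureTheory

/-- Induction on the horizon `N`. If `d σ` already reaches `c`, the bound `μ [σ]` suffices;
otherwise the event splits between the two children of `σ`, and fairness adds up their bounds. -/
theorem IsMartingale.maximal_aux {d : List Bool → ℝ≥0} (hd : IsMartingale d) (c : ℝ≥0) (N : ℕ)
    (σ : List Bool) :
    uniformMeasure (cylinder σ ∩ {X | ∃ k ≤ N, c ≤ d (initSeg X (σ.length + k))}) * c ≤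
      (2 : ℝ≥0∞)⁻¹ ^ σ.length * d σ := by
  induction N generalizing σ with
  | zero =>
    by_cases h : c ≤ d σ
    · refine mul_le_mul' ((measure_mono Set.inter_subset_left).trans
        (uniformMeasure_cylinder σ).le) (by exact_mod_cast h)
    · rw [show cylinder σ ∩ {X | ∃ k ≤ 0, c ≤ d (initSeg X (σ.length + k))} = ∅ from ?_]
      · simp
      · refine Set.eq_empty_of_forall_notMem ?_
        rintro X ⟨hX, k, hk, hc⟩
        obtain rfl : k = 0 := by omega
        rw [add_zero, mem_cylinder.1 hX] at hc
        exact h hc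
  | succ N ih =>
    by_cases h : c ≤ d σ
    · refine mul_le_mul' ((measure_mono Set.inter_subset_left).trans
        (uniformMeasure_cylinder σ).le) (by exact_mod_cast h)
    · have hsub : cylinder σ ∩ {X | ∃ k ≤ N + 1, c ≤ d (initSeg X (σ.length + k))} ⊆
          (cylinder (σ ++ [false]) ∩
            {X | ∃ k ≤ N, c ≤ d (initSeg X ((σ ++ [false]).length + k))}) ∪
          (cylinder (σ ++ [true]) ∩
            {X | ∃ k ≤ N, c ≤ d (initSeg X ((σ ++ [true]).length + k))}) := by
        rintro X ⟨hX, k, hk, hc⟩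
        rcases k with - | k
        · rw [add_zero, mem_cylinder.1 hX] at hc
          exact absurd hc h
        · have h1 : ∀ b, X σ.length = b → X ∈ cylinder (σ ++ [b]) ∩
              {X | ∃ k ≤ N, c ≤ d (initSeg X ((σ ++ [b]).length + k))} := by
            rintro b rfl
            refine ⟨?_, k, by omega, ?_⟩
            · rw [mem_cylinder, List.length_append, List.length_singleton, initSeg_succ,
                mem_cylinder.1 hX]
            · rw [List.length_append, List.length_singleton, add_assoc, add_comm 1 k]
              exact hc
          cases hb : X σ.length
          · exact Or.inl (h1 _ hb)
          · exact Or.inr (h1 _ hb)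
      calc _ ≤ (uniformMeasure (cylinder (σ ++ [false]) ∩
            {X | ∃ k ≤ N, c ≤ d (initSeg X ((σ ++ [false]).length + k))}) +
          uniformMeasure (cylinder (σ ++ [true]) ∩
            {X | ∃ k ≤ N, c ≤ d (initSeg X ((σ ++ [true]).length + k))})) * c :=
            mul_le_mul' ((measure_mono hsub).trans (measure_union_le _ _)) le_rfl
        _ ≤ (2 : ℝ≥0∞)⁻¹ ^ (σ.length + 1) * d (σ ++ [false]) +
            (2 : ℝ≥0∞)⁻¹ ^ (σ.length + 1) * d (σ ++ [true]) := by
            rw [add_mul]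
            refine add_le_add ((ih _).trans ?_) ((ih _).trans ?_) <;> simp
        _ = (2 : ℝ≥0∞)⁻¹ ^ σ.length * d σ := by
            rw [hd σ, pow_succ, mul_assoc, mul_assoc, ← mul_add, ← mul_add,
              ENNReal.coe_div (by norm_num), ENNReal.div_eq_inv_mul]
            push_cast
            rfl

theorem IsMartingale.maximal {d : List Bool → ℝ≥0} (hd : IsMartingale d) (c : ℝ≥0) :
    uniformMeasure {X | ∃ k, c ≤ d (initSeg X k)} * c ≤ d [] := by
  have h1 : {X | ∃ k, c ≤ d (initSeg X k)} = ⋃ N, {X | ∃ k ≤ N, c ≤ d (initSeg X k)} := by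
    ext X
    simp only [Set.mem_ofPred_eq, Set.mem_iUnion]
    exact ⟨fun ⟨k, hk⟩ => ⟨k, k, le_rfl, hk⟩, fun ⟨N, k, _, hk⟩ => ⟨k, hk⟩⟩
  have hmono : Monotone fun N => {X : Cantor | ∃ k ≤ N, c ≤ d (initSeg X k)} :=
    fun N M h X ⟨k, hk, hc⟩ => ⟨k, hk.trans h, hc⟩
  rw [h1, hmono.measure_iUnion, ENNReal.iSup_mul]
  refine iSup_le fun N => ?_
  have := hd.maximal_aux c N []
  simpa [cylinder, initSeg] using this

theorem MLR_subset_CR (O : Set (ℕ →. ℕ)) : MLR O ⊆ CR O := by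
  rintro X hX d hd ⟨q, hq, hqd⟩ hs
  set K : ℕ := ⌈d []⌉₊ + 1 with hK
  have hdK : d [] ≤ K := (Nat.le_ceil _).trans (by rw [hK]; push_cast; simp)
  have hap : ∀ σ, |(q σ 0 : ℝ) - (d σ : ℝ)| ≤ 1 := fun σ => by simpa using hqd σ 0
  -- Only the approximation of `d` with error `1` is consulted. A value of at least `2 ^ n * (K +
  -- 1)` forces `d` to be at least `2 ^ n * K`, because the spare `2 ^ n` absorbs the error.
  have hfc : ComputableIn O fun p : ℕ × List Bool => decide (2 ^ p.1 * (K + 1) ≤ q p.2 0) := by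
    have h1 : Primrec fun r : ℕ × ℕ => decide (2 ^ r.1 * (K + 1) ≤ r.2) :=
      (Primrec.nat_le.comp (Primrec.nat_mul.comp
        (primrec_nat_pow.comp (Primrec.const 2) Primrec.fst) (Primrec.const _)) Primrec.snd).decide
    have h2 : Primrec fun p : ℕ × List Bool => (p.2, 0) :=
      Primrec.pair Primrec.snd (Primrec.const 0)
    exact primrec_comp_computableIn (g := fun p : ℕ × List Bool => (p.1, q p.2 0)) h1
      (computableIn_pair ComputableIn.fst (computableIn_comp_primrec hq h2))
  refine notMem_MLR_of_openOf hfc ?_ ?_ ?_ hX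
  · intro m n hmn Y ⟨k, hk⟩
    refine ⟨k, ?_⟩
    simp only [decide_eq_true_eq] at hk ⊢
    exact (Nat.mul_le_mul_right _ (Nat.pow_le_pow_right (by norm_num) hmn)).trans hk
  · intro n
    have hsub : (openOf fun σ => decide (2 ^ n * (K + 1) ≤ q σ 0) = true) ⊆
        {X | ∃ k, (2 ^ n * K : ℝ≥0) ≤ d (initSeg X k)} := by
      rintro Y ⟨k, hk⟩
      refine ⟨k, ?_⟩
      simp only [decide_eq_true_eq] at hk
      have h1 := (abs_le.1 (hap (initSeg Y k))).2
      have h2 : ((2 ^ n * (K + 1) : ℕ) : ℝ) ≤ q (initSeg Y k) 0 := by exact_mod_cast hk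
      push_cast at h2
      have h3 : (1 : ℝ) ≤ 2 ^ n := one_le_pow₀ (by norm_num)
      rw [← NNReal.coe_le_coe]
      push_cast
      nlinarith
    refine (measure_mono hsub).trans ?_
    have hm := hd.maximal (2 ^ n * K)
    have hK0 : (K : ℝ≥0∞) ≠ 0 := by simp [hK]
    have h2 : uniformMeasure {X | ∃ k, (2 ^ n * K : ℝ≥0) ≤ d (initSeg X k)} * 2 ^ n * K ≤
        1 * K := by
      rw [one_mul, mul_assoc]
      refine le_trans ?_ (hm.trans (by exact_mod_cast hdK))
      push_cast
      rfl
    have h3 := (ENNReal.mul_le_mul_iff_left hK0 (ENNReal.natCast_ne_top K)).1 h2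
    rw [← ENNReal.inv_pow, ← one_div]
    exact (ENNReal.le_div_iff_mul_le (by simp) (by simp)).2 h3
  · intro n
    rw [Succeeds] at hs
    have hfr : ∃ᶠ k in Filter.atTop,
        ((2 ^ n * (K + 1) + 1 : ℝ≥0) : ℝ≥0∞) < (d (initSeg X k) : ℝ≥0∞) := by
      refine Filter.frequently_lt_of_lt_limsup ?_ ?_
      · exact Filter.isCobounded_le_of_bot
      · rw [hs]; exact ENNReal.coe_lt_top
    obtain ⟨k, hk⟩ := hfr.exists
    refine ⟨k, ?_⟩
    rw [ENNReal.coe_lt_coe, ← NNReal.coe_lt_coe] at hk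
    push_cast at hk
    have h1 := (abs_le.1 (hap (initSeg X k))).1
    rw [decide_eq_true_eq]
    have : ((2 ^ n * (K + 1) : ℕ) : ℝ) ≤ q (initSeg X k) 0 := by
      push_cast
      linarith
    exact_mod_cast this

theorem MLR_anti {O O' : Set (ℕ →. ℕ)} (h : O ⊆ O') : MLR O' ⊆ MLR O := by
  rintro X hX U ⟨⟨W, ⟨e, he, hW⟩, hU⟩, h1, h2⟩
  exact hX U ⟨⟨W, ⟨e, RecursiveIn.mono h he, hW⟩, hU⟩, h1, h2⟩

end Ville

/-! ### Solovay tests -/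

section Solovay

open MeasureTheory

/-- Weight `2 ^ (-|σ|)` of a string. -/
noncomputable def weight (σ : List Bool) : ℝ≥0∞ := (2 : ℝ≥0∞)⁻¹ ^ σ.length

open Classical in
-- The number of enumerated strings that are prefixes of `X` has integral equal to the total weight,
-- hence at most `N`. By Markov's inequality it reaches `N * 2 ^ n` with probability at most `2 ^
-- (-n)`.
theorem notMem_MLR_of_solovay {S : List Bool → ℕ → Prop} (hS : PrimrecRel S)
    (hsum : ∑' σ : {σ // ∃ t, S σ t}, weight σ ≠ ⊤) {X : Cantor}
    (hX : ∀ m, ∃ k ≥ m, ∃ t, S (initSeg X k) t) : X ∉ MLR ∅ := by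
  set N : ℕ := ⌈(∑' σ : {σ // ∃ t, S σ t}, weight σ).toReal⌉₊ + 1 with hN
  have hsumN : ∑' σ : {σ // ∃ t, S σ t}, weight σ ≤ N := by
    rw [← ENNReal.ofReal_toReal hsum, ← ENNReal.ofReal_natCast]
    refine ENNReal.ofReal_le_ofReal ((Nat.le_ceil _).trans ?_)
    rw [hN]; push_cast; linarith
  -- Bounding the enumeration stage by the length of `ρ` makes the count decidable; no string is
  -- lost, since longer prefixes allow later stages.
  let cnt : List Bool → ℕ := fun ρ =>
    ((List.range (ρ.length + 1)).filter fun k => ∃ t < ρ.length + 1, S (ρ.take k) t).length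
  have hcnt : Primrec cnt := by
    refine (primrec_countP (p := fun (ρ : List Bool) k => ∃ t < ρ.length + 1, S (ρ.take k) t)
      ?_ (Primrec.list_range.comp (Primrec.succ.comp Primrec.list_length))).of_eq
      fun ρ => by simp only [cnt]; congr!
    refine primrecPred_exists_lt (α := List Bool × ℕ) (p := fun q t => S (q.1.take q.2) t)
      (n := fun q => q.1.length + 1) ?_
      (Primrec.succ.comp (Primrec.list_length.comp Primrec.fst))
    exact hS.comp (Primrec.list_take.comp (Primrec.snd.comp Primrec.fst)
      (Primrec.fst.comp Primrec.fst)) Primrec.snd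
  have hf : Primrec fun p : ℕ × List Bool => decide (N * 2 ^ p.1 ≤ cnt p.2) :=
    (Primrec.nat_le.comp (Primrec.nat_mul.comp (Primrec.const N)
      (primrec_nat_pow.comp (Primrec.const 2) Primrec.fst))
      (hcnt.comp Primrec.snd)).decide
  refine notMem_MLR_of_openOf hf.computableIn ?_ ?_ ?_
  · intro m n hmn Y ⟨k, hk⟩
    refine ⟨k, ?_⟩
    simp only [decide_eq_true_eq] at hk ⊢
    exact (Nat.mul_le_mul_left _ (Nat.pow_le_pow_right (by norm_num) hmn)).trans hk
  · intro n
    let F : Cantor → ℝ≥0∞ := fun X =>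
      ∑' σ : {σ // ∃ t, S σ t}, (cylinder (σ : List Bool)).indicator 1 X
    have hF : ∫⁻ X, F X ∂uniformMeasure ≤ N := by
      rw [lintegral_tsum fun σ =>
        (measurable_one.indicator (measurableSet_cylinder _)).aemeasurable]
      refine le_trans (le_of_eq (tsum_congr fun σ => ?_)) hsumN
      rw [lintegral_indicator_one (measurableSet_cylinder _), uniformMeasure_cylinder, weight]
    have hFm : Measurable F := Measurable.tsum fun σ =>
      measurable_one.indicator (measurableSet_cylinder _)
    have hsub : (openOf fun ρ => decide (N * 2 ^ n ≤ cnt ρ) = true) ⊆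
        {X | (N * 2 ^ n : ℝ≥0∞) ≤ F X} := by
      rintro Y ⟨k, hk⟩
      simp only [decide_eq_true_eq] at hk
      let L : List ℕ := (List.range ((initSeg Y k).length + 1)).filter
        fun j => ∃ t < (initSeg Y k).length + 1, S ((initSeg Y k).take j) t
      have hL : ∀ j ∈ L, j ≤ k ∧ ∃ t, S (initSeg Y j) t := by
        intro j hj
        simp only [L, List.mem_filter, List.mem_range, length_initSeg, decide_eq_true_eq] at hj
        have hjk : j ≤ k := by omega
        obtain ⟨_, t, _, ht⟩ := hj
        rw [take_initSeg Y hjk] at ht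
        exact ⟨hjk, t, ht⟩
      have hnd : L.Nodup := List.nodup_range.filter _
      let s : Finset {σ // ∃ t, S σ t} := L.toFinset.attach.image fun j =>
        ⟨initSeg Y j.1, (hL j.1 (List.mem_toFinset.1 j.2)).2⟩
      have hs : s.card = L.length := by
        rw [Finset.card_image_of_injective, Finset.card_attach, List.toFinset_card_of_nodup hnd]
        intro i j hij
        have := congrArg (fun τ : {σ // ∃ t, S σ t} => τ.1.length) hij
        simp only [length_initSeg] at this
        exact Subtype.ext this
      calc (N * 2 ^ n : ℝ≥0∞) = ((N * 2 ^ n : ℕ) : ℝ≥0∞) := by push_cast; rfl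
        _ ≤ (L.length : ℝ≥0∞) := by exact_mod_cast hk
        _ = ∑ σ ∈ s, (cylinder (σ : List Bool)).indicator 1 Y := by
          rw [Finset.sum_congr rfl (g := fun _ => 1)]
          · simp [hs]
          · intro σ hσ
            obtain ⟨j, _, rfl⟩ := Finset.mem_image.1 hσ
            rw [Set.indicator_of_mem (mem_cylinder_initSeg Y _)]
            rfl
        _ ≤ F Y := ENNReal.sum_le_tsum _
    refine (measure_mono hsub).trans ?_
    have hN0 : (N : ℝ≥0∞) ≠ 0 := by simp [hN]
    have h1 := (mul_meas_ge_le_lintegral hFm (N * 2 ^ n : ℝ≥0∞) (μ := uniformMeasure)).trans hF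
    rw [← ENNReal.inv_pow, ← one_div]
    refine (ENNReal.le_div_iff_mul_le (by simp) (by simp)).2 ?_
    refine (ENNReal.mul_le_mul_iff_right hN0 (ENNReal.natCast_ne_top N)).1 ?_
    rw [mul_one, mul_comm _ (2 ^ n), ← mul_assoc]
    exact h1
  · intro n
    have hinf : {k | ∃ t, S (initSeg X k) t}.Infinite := by
      refine Set.infinite_of_not_bddAbove ?_
      rintro ⟨B, hB⟩
      obtain ⟨k, hk, h⟩ := hX (B + 1)
      have := hB h
      omega
    obtain ⟨s, hs, hcard⟩ := hinf.exists_subset_card_eq (N * 2 ^ n)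
    have ht : ∀ k : ℕ, ∃ t, k ∈ s → S (initSeg X k) t := fun k => by
      by_cases h : k ∈ s
      · obtain ⟨t, ht⟩ := hs h
        exact ⟨t, fun _ => ht⟩
      · exact ⟨0, fun h' => absurd h' h⟩
    choose T hT using ht
    refine ⟨s.sup id + s.sup T, ?_⟩
    rw [decide_eq_true_eq, ← hcard]
    set K := s.sup id + s.sup T with hK
    have : s ⊆ ((List.range (K + 1)).filter
        fun k => ∃ t < K + 1, S ((initSeg X K).take k) t).toFinset := by
      intro k hk
      have h1 : k ≤ s.sup id := Finset.le_sup (f := id) hk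
      have h2 : T k ≤ s.sup T := Finset.le_sup hk
      simp only [List.mem_toFinset, List.mem_filter, List.mem_range, decide_eq_true_eq]
      refine ⟨by omega, T k, by omega, ?_⟩
      rw [take_initSeg X (by omega)]
      exact hT k hk
    refine (Finset.card_le_card this).trans ((List.toFinset_card_le _).trans (le_of_eq ?_))
    simp only [cnt, length_initSeg]

/-- `τ` has a prefix among the first `|τ|` elements that `T` lists for the `n`-th set. -/
def Hits (T : List (Option (List Bool))) (n : ℕ) (τ : List Bool) : Prop :=
  ∃ i < τ.length, ∃ k < τ.length + 1, T[Nat.pair n i]? = some (some (τ.take k))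

theorem primrecPred_hits {α : Type*} [Primcodable α] {T : α → List (Option (List Bool))}
    {n : α → ℕ} {τ : α → List Bool} (hT : Primrec T) (hn : Primrec n) (hτ : Primrec τ) :
    PrimrecPred fun a => Hits (T a) (n a) (τ a) := by
  refine primrecPred_exists_lt ?_ (Primrec.list_length.comp hτ)
  refine primrecPred_exists_lt (α := α × ℕ)
    (p := fun q k => (T q.1)[Nat.pair (n q.1) q.2]? = some (some ((τ q.1).take k)))
    (n := fun q => (τ q.1).length + 1) ?_
    (Primrec.succ.comp (Primrec.list_length.comp (hτ.comp Primrec.fst)))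
  have h1 : Primrec fun q : (α × ℕ) × ℕ => q.1.1 := Primrec.fst.comp Primrec.fst
  refine Primrec.eq.comp (Primrec.list_getElem?.comp (hT.comp h1)
    (Primrec₂.natPair.comp (hn.comp h1) (Primrec.snd.comp Primrec.fst))) ?_
  exact Primrec.option_some.comp (Primrec.option_some.comp
    (Primrec.list_take.comp Primrec.snd (hτ.comp h1)))

open Classical in
-- Each c.e. open set of the test is regenerated by a decidable antichain: a string enters when its
-- length first suffices to see an enumerated prefix of it. The weight of the antichain is then at
-- most the measure of the open set, and these bounds form a geometric series.
theorem exists_solovay_of_notMem_MLR {O : Set (ℕ →. ℕ)} {X : Cantor} (hX : X ∉ MLR O) :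
    ∃ r : List Bool → Bool, ComputableIn O r ∧ ∑' σ : {σ // r σ = true}, weight σ ≠ ⊤ ∧
      ∀ m, ∃ k ≥ m, r (initSeg X k) = true := by
  simp only [MLR, Set.mem_ofPred_eq, not_forall, not_not] at hX
  obtain ⟨U, ⟨⟨W, ⟨e, he, hW⟩, hU⟩, -, hμ⟩, hXU⟩ := hX
  rw [Set.mem_iInter] at hXU
  let P : ℕ → List Bool → Prop := fun n τ => ∃ i < τ.length, ∃ k < τ.length + 1,
    e n i = some (τ.take k)
  let R : ℕ → List Bool → Prop := fun n τ => P n τ ∧ ¬ P n τ.dropLast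
  let tab : ℕ → List (Option (List Bool)) := fun N =>
    (List.range N).map fun j => e j.unpair.1 j.unpair.2
  have htab : ∀ (n N : ℕ) (τ : List Bool), n ≤ N → τ.length ≤ N →
      (Hits (tab (Nat.pair N N)) n τ ↔ P n τ) := by
    intro n N τ hn hτ
    refine exists_congr fun i => and_congr_right fun hi => exists_congr fun k =>
      and_congr_right fun _ => ?_
    have : Nat.pair n i < Nat.pair N N :=
      (Nat.pair_lt_pair_right n (by omega : i < N)).trans_le (by
        rcases hn.eq_or_lt with rfl | h
        · exact le_rfl
        · exact (Nat.pair_lt_pair_left N h).le)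
    simp [tab, this]
  -- The bounded search over `n` misses nothing: `P n τ` puts `[τ]` inside a set of measure at most
  -- `2 ^ (-n)`, so `n ≤ |τ|`.
  let r : List Bool → Bool := fun τ => decide (∃ n < τ.length + 1, R n τ)
  have hr : ComputableIn O r := by
    have h1 : ComputableIn O fun τ : List Bool => (tab (Nat.pair τ.length τ.length), τ) :=
      computableIn_pair (computableIn_comp_primrec
        (computableIn_map_range (g := fun j => e j.unpair.1 j.unpair.2)
          (computableIn_comp_primrec he Primrec.unpair))
        (Primrec₂.natPair.comp Primrec.list_length Primrec.list_length))
        (Primrec.computableIn Primrec.id)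
    have hdl : Primrec fun τ : List Bool => τ.dropLast :=
      (Primrec.list_take.comp (Primrec.nat_sub.comp Primrec.list_length (Primrec.const 1))
        Primrec.id).of_eq fun τ => (List.dropLast_eq_take (l := τ)).symm
    have h2 : PrimrecPred fun q : List (Option (List Bool)) × List Bool =>
        ∃ n < q.2.length + 1, Hits q.1 n q.2 ∧ ¬ Hits q.1 n q.2.dropLast := by
      refine primrecPred_exists_lt ?_ (Primrec.succ.comp (Primrec.list_length.comp Primrec.snd))
      have h3 := Primrec.snd.comp
        (Primrec.fst (α := List (Option (List Bool)) × List Bool) (β := ℕ))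
      exact (primrecPred_hits (Primrec.fst.comp Primrec.fst) Primrec.snd h3).and
        (primrecPred_hits (Primrec.fst.comp Primrec.fst) Primrec.snd (hdl.comp h3)).not
    have h4 := primrec_comp_computableIn h2.decide h1
    refine (funext fun τ => ?_ : _ = r) ▸ h4
    simp only [r, R]
    refine decide_eq_decide.2 (exists_congr fun n => and_congr_right fun hn => ?_)
    rw [htab n _ τ (by omega) le_rfl, htab n _ τ.dropLast (by omega) (by simp)]
  have hPU : ∀ n τ, P n τ → cylinder τ ⊆ U n := by
    rintro n τ ⟨i, _, k, hk, hik⟩ Y hY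
    rw [hU, openGenerated]
    refine Set.mem_biUnion (x := τ.take k) (by rw [hW]; exact ⟨i, hik⟩) ?_
    have : initSeg Y (min k τ.length) = τ.take k := by
      rw [← mem_cylinder.1 hY, length_initSeg, ← take_initSeg Y (min_le_right k τ.length),
        mem_cylinder.1 hY]
      conv_rhs => rw [List.take_eq_take_min]
    rw [mem_cylinder, List.length_take, this]
  have hPmono : ∀ n (Y : Cantor) j k, j ≤ k → P n (initSeg Y j) → P n (initSeg Y k) := by
    rintro n Y j k hjk ⟨i, hi, l, hl, hil⟩
    simp only [length_initSeg] at hi hl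
    refine ⟨i, by rw [length_initSeg]; omega, l, by rw [length_initSeg]; omega, ?_⟩
    rw [hil, take_initSeg Y (by omega), take_initSeg Y (by omega)]
  have hlen : ∀ n τ, P n τ → n ≤ τ.length := by
    intro n τ h
    have h1 := (measure_mono (hPU n τ h)).trans (hμ n)
    rw [uniformMeasure_cylinder] at h1
    by_contra hlt
    have : (2 : ℝ≥0∞)⁻¹ ^ n < 2⁻¹ ^ τ.length := by
      rw [← ENNReal.inv_pow, ← ENNReal.inv_pow, ENNReal.inv_lt_inv]
      exact_mod_cast Nat.pow_lt_pow_right (by norm_num) (not_le.1 hlt)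
    exact absurd h1 (not_le.2 this)
  have hRsum : ∀ n, ∑' σ : {σ // R n σ}, weight σ ≤ (2 : ℝ≥0∞)⁻¹ ^ n := by
    intro n
    refine le_trans (le_of_eq ?_) (hμ n |>.trans' (measure_mono
      (Set.iUnion_subset fun σ : {σ // R n σ} => hPU n σ σ.2.1)))
    rw [measure_iUnion]
    · exact tsum_congr fun σ => (uniformMeasure_cylinder _).symm
    · have key : ∀ σ τ : {σ // R n σ}, ∀ Y, Y ∈ cylinder σ.1 → Y ∈ cylinder τ.1 →
          ¬ σ.1.length < τ.1.length := by
        intro σ τ Y hσ hτ hlt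
        refine τ.2.2 ?_
        rw [← mem_cylinder.1 hτ, dropLast_initSeg]
        refine hPmono n Y σ.1.length _ (by omega) ?_
        rw [mem_cylinder.1 hσ]
        exact σ.2.1
      intro σ τ hne
      refine Set.disjoint_left.2 fun Y hσ hτ => hne ?_
      have h1 := key σ τ Y hσ hτ
      have h2 := key τ σ Y hτ hσ
      refine Subtype.ext ?_
      rw [← mem_cylinder.1 hσ, ← mem_cylinder.1 hτ, le_antisymm (not_lt.1 h2) (not_lt.1 h1)]
    · exact fun σ => measurableSet_cylinder _
  refine ⟨r, hr, ?_, ?_⟩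
  · have h1 : ∑' σ : {σ // r σ = true}, weight σ ≤ ∑' n, ∑' σ : {σ // R n σ}, weight σ := by
      refine le_trans (ENNReal.tsum_mono_subtype weight ?_)
        (ENNReal.tsum_iUnion_le_tsum weight fun n => {σ | R n σ})
      intro σ hσ
      obtain ⟨n, _, hn⟩ := of_decide_eq_true (show r σ = true from hσ)
      exact Set.mem_iUnion.2 ⟨n, hn⟩
    refine ne_top_of_le_ne_top ?_ (h1.trans (ENNReal.tsum_le_tsum hRsum))
    rw [ENNReal.tsum_geometric]
    simp
  · intro m
    have hex : ∃ k, P m (initSeg X k) := by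
      have h := hXU m
      rw [hU, openGenerated] at h
      obtain ⟨σ, hσ, hXσ⟩ := Set.mem_iUnion₂.1 h
      rw [hW] at hσ
      obtain ⟨i, hi⟩ := hσ
      refine ⟨σ.length + i + 1, i, by rw [length_initSeg]; omega, σ.length, by rw [length_initSeg]; omega, ?_⟩
      rw [take_initSeg X (by omega), mem_cylinder.1 hXσ, hi]
    have hk := Nat.find_spec hex
    have hk1 : R m (initSeg X (Nat.find hex)) := by
      refine ⟨hk, fun h => ?_⟩
      rw [dropLast_initSeg] at h
      -- The empty string satisfies no `P m`, as no stage lies below its length; so dropping the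
      -- last bit really shortens the prefix.
      have h0 : 0 < Nat.find hex := by
        obtain ⟨i, hi, -⟩ := hk
        simp only [length_initSeg] at hi
        omega
      exact Nat.find_min hex (by omega) h
    have hmk := hlen _ _ hk
    rw [length_initSeg] at hmk
    exact ⟨Nat.find hex, hmk, decide_eq_true ⟨m, by rw [length_initSeg]; omega, hk1⟩⟩

end Solovay

/-! ### A c.e. open set of small measure containing all non-random sequences -/

section Universal

open MeasureTheory Nat.Partrec

/-- Within `|ρ|` steps the program `c` lists a prefix of `ρ` in the set with index `c + 2`. -/
def ListsPrefix (c : ℕ) (ρ : List Bool) : Prop :=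
  ∃ i < ρ.length, ∃ k < ρ.length + 1, Code.evaln ρ.length (Denumerable.ofNat Code c)
    (Nat.pair (c + 2) i) = some (Encodable.encode (some (ρ.take k)))

theorem primrecRel_listsPrefix : PrimrecRel ListsPrefix := by
  refine primrecPred_exists_lt ?_ (Primrec.list_length.comp Primrec.snd)
  refine primrecPred_exists_lt (α := (ℕ × List Bool) × ℕ)
    (p := fun q k => Code.evaln q.1.2.length (Denumerable.ofNat Code q.1.1)
      (Nat.pair (q.1.1 + 2) q.2) = some (Encodable.encode (some (q.1.2.take k))))
    (n := fun q => q.1.2.length + 1) ?_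
    (Primrec.succ.comp (Primrec.list_length.comp (Primrec.snd.comp Primrec.fst)))
  have hc : Primrec fun q : ((ℕ × List Bool) × ℕ) × ℕ => q.1.1.1 :=
    Primrec.fst.comp (Primrec.fst.comp Primrec.fst)
  have hρ : Primrec fun q : ((ℕ × List Bool) × ℕ) × ℕ => q.1.1.2 :=
    Primrec.snd.comp (Primrec.fst.comp Primrec.fst)
  have h1 := Code.primrec_evaln.comp (Primrec.pair (Primrec.pair
    (Primrec.list_length.comp hρ) ((Primrec.ofNat Code).comp hc))
    (Primrec₂.natPair.comp (Primrec.nat_add.comp hc (Primrec.const 2))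
      (Primrec.snd.comp Primrec.fst)))
  exact Primrec.eq.comp h1 (Primrec.option_some.comp (Primrec.encode.comp
    (Primrec.option_some.comp (Primrec.list_take.comp Primrec.snd hρ))))

theorem ListsPrefix.mono {c : ℕ} {X : Cantor} {m n : ℕ} (hmn : m ≤ n)
    (h : ListsPrefix c (initSeg X m)) : ListsPrefix c (initSeg X n) := by
  obtain ⟨i, hi, k, hk, h⟩ := h
  rw [length_initSeg] at *
  rw [take_initSeg X (by omega)] at h
  refine ⟨i, by rw [length_initSeg]; omega, k, by rw [length_initSeg]; omega, ?_⟩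
  rw [length_initSeg, take_initSeg X (by omega)]
  exact Code.evaln_mono hmn h

open Classical in
/-- The strings of length `n` on which `ListsPrefix c` holds have total weight at most
`2 ^ (-(c + 2))`. -/
def FewListed (c n : ℕ) : Prop :=
  ((allStrings n).filter fun ρ => ListsPrefix c ρ).length * 2 ^ (c + 2) ≤ 2 ^ n

/-- The generating predicate of the second component of a universal Martin-Löf test. -/
def UniversalPred (ρ : List Bool) : Prop :=
  ∃ c < ρ.length, ListsPrefix c ρ ∧ FewListed c ρ.length

theorem primrecRel_fewListed : PrimrecRel FewListed := by
  classical
  have h1 : Primrec fun q : ℕ × ℕ =>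
      ((allStrings q.2).filter fun ρ => ListsPrefix q.1 ρ).length :=
    primrec_countP (p := fun (q : ℕ × ℕ) ρ => ListsPrefix q.1 ρ)
      (primrecRel_listsPrefix.comp (Primrec.fst.comp Primrec.fst) Primrec.snd)
      (primrec_allStrings.comp Primrec.snd)
  exact (Primrec.nat_le.comp (Primrec.nat_mul.comp h1 (primrec_nat_pow.comp (Primrec.const 2)
    (Primrec.nat_add.comp Primrec.fst (Primrec.const 2))))
    (primrec_nat_pow.comp (Primrec.const 2) Primrec.snd)).of_eq fun q => by
      rw [FewListed]

theorem primrecPred_universalPred : PrimrecPred UniversalPred := by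
  refine primrecPred_exists_lt ?_ Primrec.list_length
  exact (primrecRel_listsPrefix.comp Primrec.snd Primrec.fst).and
    (primrecRel_fewListed.comp Primrec.snd (Primrec.list_length.comp Primrec.fst))

theorem count_mul_le_iff {k a n : ℕ} :
    (k : ℝ≥0∞) * 2⁻¹ ^ n ≤ 2⁻¹ ^ a ↔ k * 2 ^ a ≤ 2 ^ n := by
  rw [← ENNReal.inv_pow, ← ENNReal.inv_pow, ← div_eq_mul_inv,
    ENNReal.div_le_iff (by simp) (by simp), mul_comm, ← div_eq_mul_inv,
    ENNReal.le_div_iff_mul_le (by simp) (by simp)]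
  exact_mod_cast Iff.rfl

theorem uniformMeasure_listsPrefix_le {c n : ℕ} (h : FewListed c n) :
    uniformMeasure {X | ListsPrefix c (initSeg X n)} ≤ (2 : ℝ≥0∞)⁻¹ ^ (c + 2) := by
  classical
  rw [uniformMeasure_initSeg_mem, count_mul_le_iff]
  exact h

theorem fewListed_of_uniformMeasure_le {c n : ℕ}
    (h : uniformMeasure {X | ListsPrefix c (initSeg X n)} ≤ (2 : ℝ≥0∞)⁻¹ ^ (c + 2)) :
    FewListed c n := by
  classical
  rw [uniformMeasure_initSeg_mem, count_mul_le_iff] at h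
  exact h

/-- For fixed `c` the sets indexed by `n` are directed: `ListsPrefix` persists as `n` grows, and
stages violating `FewListed` contribute the empty set. The union over `n` thus has measure at most
`2 ^ (-(c + 2))`, and these bounds sum to `1/2`. -/
theorem uniformMeasure_openOf_universalPred_le :
    uniformMeasure (openOf UniversalPred) ≤ 2⁻¹ := by
  have hsub : openOf UniversalPred ⊆
      ⋃ c, ⋃ n, {X | ListsPrefix c (initSeg X n) ∧ FewListed c n} := by
    rintro X ⟨n, c, _, h1, h2⟩
    rw [length_initSeg] at h2
    exact Set.mem_iUnion₂.2 ⟨c, n, h1, h2⟩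
  have hc : ∀ c, uniformMeasure (⋃ n, {X | ListsPrefix c (initSeg X n) ∧ FewListed c n}) ≤
      (2 : ℝ≥0∞)⁻¹ ^ (c + 2) := by
    intro c
    rw [Directed.measure_iUnion]
    · refine iSup_le fun n => ?_
      by_cases h : FewListed c n
      · exact (measure_mono fun X hX => hX.1).trans (uniformMeasure_listsPrefix_le h)
      · simp [h]
    · have : ∀ m n, m ≤ n → ∃ k,
          {X | ListsPrefix c (initSeg X m) ∧ FewListed c m} ⊆
            {X | ListsPrefix c (initSeg X k) ∧ FewListed c k} ∧
          {X | ListsPrefix c (initSeg X n) ∧ FewListed c n} ⊆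
            {X | ListsPrefix c (initSeg X k) ∧ FewListed c k} := by
        intro m n hmn
        by_cases h : FewListed c n
        · exact ⟨n, fun X hX => ⟨hX.1.mono hmn, h⟩, fun X hX => hX⟩
        · exact ⟨m, fun X hX => hX, fun X hX => absurd hX.2 h⟩
      intro m n
      rcases le_total m n with h | h
      · exact this m n h
      · obtain ⟨k, h1, h2⟩ := this n m h
        exact ⟨k, h2, h1⟩
  refine (measure_mono hsub).trans ((measure_iUnion_le _).trans ((ENNReal.tsum_le_tsum hc).trans ?_))
  simp_rw [pow_add]
  rw [ENNReal.tsum_mul_right, ENNReal.tsum_geometric, ENNReal.one_sub_inv_two, inv_inv, pow_two,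
    ← mul_assoc, ENNReal.mul_inv_cancel (by simp) (by simp), one_mul]

/-- If `c` codes the enumeration of a test, its component with index `c + 2` obeys the measure bound
at every stage, so the cutoff `FewListed` never removes anything. -/
theorem mem_openOf_universalPred_of_notMem_MLR {X : Cantor} (hX : X ∉ MLR ∅) :
    X ∈ openOf UniversalPred := by
  simp only [MLR, Set.mem_ofPred_eq, not_forall, not_not] at hX
  obtain ⟨U, ⟨⟨W, ⟨e, he, hW⟩, hU⟩, -, hμ⟩, hXU⟩ := hX
  rw [Set.mem_iInter] at hXU
  have he' : Nat.Partrec fun n => Part.bind (Part.ofOption (Encodable.decode (α := ℕ × ℕ) n))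
      fun a => (Part.some (e a.1 a.2)).map Encodable.encode :=
    recursiveIn_empty_iff.1 he
  obtain ⟨code, hcode⟩ := Code.exists_code.1 he'
  set c := Encodable.encode code with hc
  have hcode' : ∀ n i, code.eval (Nat.pair n i) = Part.some (Encodable.encode (e n i)) := by
    intro n i
    rw [hcode]
    simp
  have hLU : ∀ t, {X | ListsPrefix c (initSeg X t)} ⊆ U (c + 2) := by
    rintro t Y ⟨i, hi, k, hk, h⟩
    rw [hc, Denumerable.ofNat_encode, ← hc] at h
    have h1 := Code.evaln_sound h
    rw [hcode', Part.mem_some_iff] at h1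
    have h2 := Encodable.encode_injective h1
    rw [length_initSeg] at hk
    rw [hU, openGenerated]
    refine Set.mem_biUnion (x := initSeg Y k) ?_ (mem_cylinder_initSeg Y k)
    rw [hW]
    refine ⟨i, ?_⟩
    rw [← h2, take_initSeg Y (by omega)]
  have h := hXU (c + 2)
  rw [hU, openGenerated] at h
  obtain ⟨σ, hσ, hXσ⟩ := Set.mem_iUnion₂.1 h
  rw [hW] at hσ
  obtain ⟨i, hi⟩ := hσ
  have h1 : Encodable.encode (some σ) ∈ code.eval (Nat.pair (c + 2) i) := by
    rw [hcode', hi]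
    exact Part.mem_some _
  obtain ⟨s, hs⟩ := Code.evaln_complete.1 h1
  -- The prefix length must dominate everything searched below it: the halting stage, the
  -- enumeration index, the length of `σ` and the code `c`.
  set t := s + i + σ.length + c + 1 with ht
  refine ⟨t, c, by rw [length_initSeg]; omega, ⟨i, by rw [length_initSeg]; omega, σ.length,
    by rw [length_initSeg]; omega, ?_⟩, ?_⟩
  · rw [length_initSeg, take_initSeg X (by omega), mem_cylinder.1 hXσ, hc,
      Denumerable.ofNat_encode, ← hc]
    exact Code.evaln_mono (by omega) hs
  · rw [length_initSeg]
    exact fewListed_of_uniformMeasure_le ((measure_mono (hLU t)).trans (hμ _))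

end Universal

/-! ### Independent events on disjoint columns -/

section Events

open MeasureTheory

/-- The event that the first `l` bits of the `i`-th column of `X` are all `1`. -/
def ev (i l : ℕ) : Set Cantor := {X | ∀ j < l, X (Nat.pair i j) = true}

theorem ev_eq_pi (i l : ℕ) : ev i l =
    Set.pi ((Finset.range l).image (Nat.pair i) : Finset ℕ) fun _ => {true} := by
  ext X
  simp [ev]

theorem isOpen_ev (i l : ℕ) : IsOpen (ev i l) := by
  rw [ev_eq_pi]
  exact isOpen_set_pi (Finset.finite_toSet _) fun _ _ => isOpen_discrete _

theorem measurableSet_ev (i l : ℕ) : MeasurableSet (ev i l) := by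
  rw [ev_eq_pi]
  exact MeasurableSet.pi (Finset.countable_toSet _) fun _ _ => MeasurableSet.of_discrete

/-- Independence, by induction on `s`. Removing `ev a (ℓ a)` subtracts a term of the same shape,
because that event fixes further coordinates and can be merged into `T`; this is why general
coordinate constraints are carried along. -/
theorem measureReal_pi_inter_compl_ev (ℓ : ℕ → ℕ) (s : Finset ℕ) (T : Finset ℕ) (b : ℕ → Bool)
    (hT : ∀ i ∈ s, ∀ j, Nat.pair i j ∉ T) :
    uniformMeasure.real (Set.pi T (fun i => {b i}) ∩ ⋂ i ∈ s, (ev i (ℓ i))ᶜ) =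
      2⁻¹ ^ T.card * ∏ i ∈ s, (1 - 2⁻¹ ^ ℓ i) := by
  induction s using Finset.induction_on generalizing T b with
  | empty => simp [Measure.real, uniformMeasure_pi]
  | insert a s ha ih =>
    set G : Finset ℕ := (Finset.range (ℓ a)).image (Nat.pair a) with hG
    have hGT : Disjoint T G := by
      refine Finset.disjoint_left.2 fun p hp hpG => ?_
      obtain ⟨j, _, rfl⟩ := Finset.mem_image.1 hpG
      exact hT a (Finset.mem_insert_self a s) j hp
    have hGc : G.card = ℓ a := by
      rw [Finset.card_image_of_injective _ fun j k h => (Nat.pair_eq_pair.1 h).2,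
        Finset.card_range]
    have h1 := ih T b fun i hi => hT i (Finset.mem_insert_of_mem hi)
    have h2 := ih (T ∪ G) (fun p => if p ∈ G then true else b p) (by
      intro i hi j hj
      rcases Finset.mem_union.1 hj with h | h
      · exact hT i (Finset.mem_insert_of_mem hi) j h
      · obtain ⟨k, _, hk⟩ := Finset.mem_image.1 h
        rw [Nat.pair_eq_pair] at hk
        exact ha (hk.1 ▸ hi))
    have h3 : Set.pi (T ∪ G : Finset ℕ) (fun p => {if p ∈ G then true else b p}) =
        Set.pi T (fun i => {b i}) ∩ ev a (ℓ a) := by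
      ext X
      simp only [Set.mem_pi, Finset.mem_coe, Finset.mem_union, Set.mem_singleton_iff,
        Set.mem_inter_iff, ev, Set.mem_ofPred_eq]
      constructor
      · intro h
        refine ⟨fun p hp => ?_, fun j hj => ?_⟩
        · rw [h p (Or.inl hp), if_neg (Finset.disjoint_left.1 hGT hp)]
        · have : Nat.pair a j ∈ G := Finset.mem_image_of_mem _ (Finset.mem_range.2 hj)
          rw [h _ (Or.inr this), if_pos this]
      · rintro ⟨h, h'⟩ p hp
        by_cases hpG : p ∈ G
        · rw [if_pos hpG]
          obtain ⟨j, hj, rfl⟩ := Finset.mem_image.1 hpG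
          exact h' j (Finset.mem_range.1 hj)
        · rw [if_neg hpG]
          exact h p (hp.resolve_right hpG)
    rw [h3, Finset.card_union_of_disjoint hGT, hGc] at h2
    have h4 := measureReal_inter_add_sdiff (μ := uniformMeasure)
      (s := Set.pi T (fun i => {b i}) ∩ ⋂ i ∈ s, (ev i (ℓ i))ᶜ) (measurableSet_ev a (ℓ a))
    rw [Set.inter_right_comm, h2, h1] at h4
    rw [Finset.set_biInter_insert, Finset.prod_insert ha, ← Set.inter_assoc,
      Set.inter_right_comm, ← Set.sdiff_eq]
    rw [pow_add] at h4
    linarith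

theorem measureReal_cylinder_inter_compl_ev (ℓ : ℕ → ℕ) (s : Finset ℕ) (σ : List Bool)
    (hs : ∀ i ∈ s, σ.length ≤ i) :
    uniformMeasure.real (cylinder σ ∩ ⋂ i ∈ s, (ev i (ℓ i))ᶜ) =
      2⁻¹ ^ σ.length * ∏ i ∈ s, (1 - 2⁻¹ ^ ℓ i) := by
  rw [cylinder_eq_pi, measureReal_pi_inter_compl_ev, Finset.card_range]
  intro i hi j hj
  have := Nat.left_le_pair i j
  have := hs i hi
  rw [Finset.mem_range] at hj
  omega

end Events

/-! ### The martingale betting on the events -/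

section BettingMartingale

/-- The factor by which a bet that the next bit is `1` changes the capital. -/
def gain : Option Bool → ℕ
  | none => 1
  | some false => 0
  | some true => 2

/-- The capital, starting from `1`, of the strategy that bets everything on the event `ev i l`. -/
def capital (i l : ℕ) (σ : List Bool) : ℕ := ∏ j ∈ Finset.range l, gain σ[Nat.pair i j]?

/-- The new bit is read by at most one factor, which changes from `1` to `0` or `2`; all other
factors stay the same. -/
theorem capital_append (i l : ℕ) (σ : List Bool) :
    capital i l (σ ++ [false]) + capital i l (σ ++ [true]) = 2 * capital i l σ := by
  have hne : ∀ (b : Bool) (p : ℕ), p ≠ σ.length → (σ ++ [b])[p]? = σ[p]? := by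
    intro b p hp
    rcases lt_or_gt_of_ne hp with h | h
    · rw [List.getElem?_append_left h]
    · rw [List.getElem?_eq_none (by simp; omega), List.getElem?_eq_none (by omega)]
  by_cases h : ∃ j ∈ Finset.range l, Nat.pair i j = σ.length
  · obtain ⟨j, hj, hjσ⟩ := h
    unfold capital
    rw [← Finset.mul_prod_erase _ _ hj, ← Finset.mul_prod_erase _ _ hj,
      ← Finset.mul_prod_erase _ _ hj]
    have he : ∀ b, ∏ k ∈ (Finset.range l).erase j, gain (σ ++ [b])[Nat.pair i k]? =
        ∏ k ∈ (Finset.range l).erase j, gain σ[Nat.pair i k]? := by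
      intro b
      refine Finset.prod_congr rfl fun k hk => ?_
      rw [hne b]
      intro hk'
      rw [← hjσ, Nat.pair_eq_pair] at hk'
      exact (Finset.mem_erase.1 hk).1 hk'.2
    rw [he, he, hjσ]
    simp [gain]
  · have he : ∀ b, capital i l (σ ++ [b]) = capital i l σ := by
      intro b
      refine Finset.prod_congr rfl fun k hk => ?_
      rw [hne b _ fun hk' => h ⟨k, hk, hk'⟩]
    rw [he, he, two_mul]

theorem capital_eq_one {i l : ℕ} {σ : List Bool} (h : σ.length ≤ i) : capital i l σ = 1 := by
  refine Finset.prod_eq_one fun j _ => ?_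
  rw [List.getElem?_eq_none (h.trans (Nat.left_le_pair i j))]
  rfl

theorem capital_eq_two_pow {i l : ℕ} {X : Cantor} (hX : X ∈ ev i l) {n : ℕ}
    (hn : Nat.pair i l ≤ n) : capital i l (initSeg X n) = 2 ^ l := by
  rw [capital, Finset.prod_congr rfl (g := fun _ => 2)]
  · simp
  · intro j hj
    rw [Finset.mem_range] at hj
    rw [getElem?_initSeg, if_pos ((Nat.pair_lt_pair_right i hj).trans_le hn), hX j hj]
    rfl

theorem primrec_capital {ℓ : ℕ → ℕ} (hℓ : Primrec ℓ) :
    Primrec₂ fun (i : ℕ) (σ : List Bool) => capital i (ℓ i) σ := by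
  refine primrec_prod_range (α := ℕ × List Bool) ?_ (hℓ.comp Primrec.fst)
  have hg : Primrec gain := Primrec.dom_finite _
  exact hg.comp (Primrec.list_getElem?.comp (Primrec.snd.comp Primrec.fst)
    (Primrec₂.natPair.comp (Primrec.fst.comp Primrec.fst) Primrec.snd))

variable (ℓ : ℕ → ℕ) (b : ℕ → Bool)

/-- The stake placed on the event `ev i (ℓ i)`. -/
noncomputable def stake (i : ℕ) : ℝ≥0 := if b i then 2⁻¹ ^ ℓ i else 0

theorem summable_stake_mul_capital (hsum : Summable (stake ℓ b)) (σ : List Bool) :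
    Summable fun i => stake ℓ b i * capital i (ℓ i) σ := by
  rw [← NNReal.summable_nat_add_iff σ.length] at hsum ⊢
  refine hsum.congr fun i => ?_
  rw [capital_eq_one (by omega), Nat.cast_one, mul_one]

/-- The combined strategy, with initial capital `C`, that puts `stake ℓ b i` on each event
`ev i (ℓ i)`. -/
noncomputable def bet (C : ℝ≥0) (σ : List Bool) : ℝ≥0 :=
  (C - ∑' i, stake ℓ b i) + ∑' i, stake ℓ b i * capital i (ℓ i) σ

theorem isMartingale_bet (hsum : Summable (stake ℓ b)) (C : ℝ≥0) :
    IsMartingale (bet ℓ b C) := by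
  intro σ
  have h : ∑' i, stake ℓ b i * capital i (ℓ i) (σ ++ [false]) +
      ∑' i, stake ℓ b i * capital i (ℓ i) (σ ++ [true]) =
      2 * ∑' i, stake ℓ b i * capital i (ℓ i) σ := by
    rw [← (summable_stake_mul_capital ℓ b hsum _).tsum_add
      (summable_stake_mul_capital ℓ b hsum _), ← NNReal.tsum_mul_left]
    refine tsum_congr fun i => ?_
    have := capital_append i (ℓ i) σ
    have h' : (capital i (ℓ i) (σ ++ [false]) : ℝ≥0) + capital i (ℓ i) (σ ++ [true]) =
        2 * capital i (ℓ i) σ := by exact_mod_cast this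
    rw [← mul_add, h']
    ring
  rw [eq_div_iff two_ne_zero]
  unfold bet
  rw [add_add_add_comm, h]
  ring

/-- Bets on events with index at least `|σ|` are still untouched, so their capital cancels against
the same tail in the total stake. The value becomes a finite sum, which gives computability although
the total stake may be an uncomputable real. -/
theorem bet_eq (hsum : Summable (stake ℓ b)) {C : ℝ≥0} (hC : ∑' i, stake ℓ b i ≤ C)
    (σ : List Bool) : (bet ℓ b C σ : ℝ) = C +
      ∑ i ∈ Finset.range σ.length, (stake ℓ b i : ℝ) * capital i (ℓ i) σ -
      ∑ i ∈ Finset.range σ.length, (stake ℓ b i : ℝ) := by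
  have h1 := NNReal.sum_add_tsum_nat_add σ.length hsum
  have h2 := NNReal.sum_add_tsum_nat_add σ.length (summable_stake_mul_capital ℓ b hsum σ)
  have h3 : ∑' i, stake ℓ b (i + σ.length) * capital (i + σ.length) (ℓ (i + σ.length)) σ =
      ∑' i, stake ℓ b (i + σ.length) := tsum_congr fun i => by
    rw [capital_eq_one (by omega), Nat.cast_one, mul_one]
  rw [h3] at h2
  rw [bet, NNReal.coe_add, NNReal.coe_sub hC, h1, h2]
  push_cast
  ring

theorem computableReal_bet {O : Set (ℕ →. ℕ)} (hℓ : Primrec ℓ) (hb : ComputableIn O b)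
    (hsum : Summable (stake ℓ b)) {C : ℕ} (hC : ∑' i, stake ℓ b i ≤ C) :
    ComputableReal O (bet ℓ b C) := by
  -- A common exponent: `T σ` is at least every `ℓ i` with `i < |σ|`, so `bet ℓ b C σ` is the
  -- integer `D` over `2 ^ T σ`.
  let T : List Bool → ℕ := fun σ => ∑ i ∈ Finset.range σ.length, ℓ i
  let D : List Bool → List Bool → ℕ := fun t σ => C * 2 ^ T σ +
    ∑ i ∈ Finset.range σ.length, (t.getD i false).toNat * 2 ^ (T σ - ℓ i) * capital i (ℓ i) σ -
    ∑ i ∈ Finset.range σ.length, (t.getD i false).toNat * 2 ^ (T σ - ℓ i)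
  let tab : ℕ → List Bool := fun n => (List.range n).map b
  have hT : Primrec T := primrec_sum_range (f := fun _ i => ℓ i) (hℓ.comp Primrec.snd)
    Primrec.list_length
  have hst : Primrec fun p : (List Bool × List Bool) × ℕ =>
      (p.1.1.getD p.2 false).toNat * 2 ^ (T p.1.2 - ℓ p.2) := by
    have h1 : Primrec Bool.toNat := Primrec.dom_finite _
    exact Primrec.nat_mul.comp (h1.comp ((Primrec.list_getD false).comp
      (Primrec.fst.comp Primrec.fst) Primrec.snd)) (primrec_nat_pow.comp (Primrec.const 2)
        (Primrec.nat_sub.comp (hT.comp (Primrec.snd.comp Primrec.fst)) (hℓ.comp Primrec.snd)))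
  have hD : Primrec₂ D := by
    refine Primrec.nat_sub.comp (Primrec.nat_add.comp (Primrec.nat_mul.comp (Primrec.const C)
      (primrec_nat_pow.comp (Primrec.const 2) (hT.comp Primrec.snd))) ?_) ?_
    · refine primrec_sum_range (α := List Bool × List Bool)
        (f := fun p i => (p.1.getD i false).toNat * 2 ^ (T p.2 - ℓ i) * capital i (ℓ i) p.2)
        ?_ (Primrec.list_length.comp Primrec.snd)
      exact Primrec.nat_mul.comp hst ((primrec_capital hℓ).comp Primrec.snd
        (Primrec.snd.comp Primrec.fst))
    · exact primrec_sum_range (α := List Bool × List Bool)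
        (f := fun p i => (p.1.getD i false).toNat * 2 ^ (T p.2 - ℓ i))
        hst (Primrec.list_length.comp Primrec.snd)
  refine ⟨fun σ n => 2 ^ n * D (tab σ.length) σ / 2 ^ T σ, ?_, fun σ n => ?_⟩
  · have h1 : Primrec fun p : List Bool × List Bool × ℕ =>
        2 ^ p.2.2 * D p.1 p.2.1 / 2 ^ T p.2.1 :=
      Primrec.nat_div.comp (Primrec.nat_mul.comp
        (primrec_nat_pow.comp (Primrec.const 2) (Primrec.snd.comp Primrec.snd))
        (hD.comp Primrec.fst (Primrec.fst.comp Primrec.snd)))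
        (primrec_nat_pow.comp (Primrec.const 2) (hT.comp (Primrec.fst.comp Primrec.snd)))
    exact primrec_comp_computableIn (g := fun p : List Bool × ℕ => (tab p.1.length, p)) h1
      (computableIn_pair (computableIn_comp_primrec (computableIn_map_range hb)
        (Primrec.list_length.comp Primrec.fst)) ComputableIn.id)
  · have hstake : ∀ i ∈ Finset.range σ.length,
        (stake ℓ b i : ℝ) = (((tab σ.length).getD i false).toNat * 2 ^ (T σ - ℓ i) : ℕ) / 2 ^ T σ := by
      intro i hi
      have hle : ℓ i ≤ T σ := Finset.single_le_sum (f := ℓ) (fun _ _ => Nat.zero_le _) hi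
      have htab : (tab σ.length).getD i false = b i := by
        simp [tab, List.getD_eq_getElem?_getD, Finset.mem_range.1 hi]
      rw [htab, stake, eq_div_iff (by positivity)]
      cases b i
      · simp
      · obtain ⟨m, hm⟩ := Nat.exists_eq_add_of_le hle
        rw [hm]
        simp [pow_add]
    have hbet := bet_eq ℓ b hsum hC σ
    set A := ∑ i ∈ Finset.range σ.length,
      ((tab σ.length).getD i false).toNat * 2 ^ (T σ - ℓ i) * capital i (ℓ i) σ with hA
    set B := ∑ i ∈ Finset.range σ.length,
      ((tab σ.length).getD i false).toNat * 2 ^ (T σ - ℓ i) with hB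
    have hA' : ∑ i ∈ Finset.range σ.length, (stake ℓ b i : ℝ) * capital i (ℓ i) σ =
        A / 2 ^ T σ := by
      rw [hA, Nat.cast_sum, Finset.sum_div]
      refine Finset.sum_congr rfl fun i hi => ?_
      rw [hstake i hi]
      push_cast
      ring
    have hB' : ∑ i ∈ Finset.range σ.length, (stake ℓ b i : ℝ) = B / 2 ^ T σ := by
      rw [hB, Nat.cast_sum, Finset.sum_div]
      exact Finset.sum_congr rfl fun i hi => hstake i hi
    have hpos : (0 : ℝ) < 2 ^ T σ := by positivity
    rw [hA', hB'] at hbet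
    -- Non-negativity of the martingale shows that the truncated subtraction in `D` is exact.
    have hle : B ≤ C * 2 ^ T σ + A := by
      have h0 : (0 : ℝ) ≤ bet ℓ b C σ := NNReal.coe_nonneg _
      have h1 : (bet ℓ b C σ : ℝ) * 2 ^ T σ = C * 2 ^ T σ + A - B := by
        rw [hbet]; push_cast; field_simp
      have h2 : (B : ℝ) ≤ C * 2 ^ T σ + A := by nlinarith
      exact_mod_cast h2
    have hD' : (D (tab σ.length) σ : ℝ) = bet ℓ b C σ * 2 ^ T σ := by
      have : D (tab σ.length) σ = C * 2 ^ T σ + A - B := rfl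
      rw [this, Nat.cast_sub hle, hbet]
      push_cast
      field_simp
    have hdiv : (bet ℓ b C σ : ℝ) * 2 ^ n = ((2 ^ n * D (tab σ.length) σ : ℕ) : ℝ) / (2 ^ T σ : ℕ) := by
      push_cast
      rw [hD']
      field_simp
    have hfl : |((2 ^ n * D (tab σ.length) σ / 2 ^ T σ : ℕ) : ℝ) - bet ℓ b C σ * 2 ^ n| ≤ 1 := by
      rw [hdiv, ← Nat.floor_div_eq_div (K := ℝ)]
      have h1 := Nat.floor_le (a := ((2 ^ n * D (tab σ.length) σ : ℕ) : ℝ) / (2 ^ T σ : ℕ))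
        (by positivity)
      have h2 := Nat.lt_floor_add_one (((2 ^ n * D (tab σ.length) σ : ℕ) : ℝ) / (2 ^ T σ : ℕ))
      rw [abs_le]
      constructor <;> linarith
    have h2n : (0 : ℝ) < 2 ^ n := by positivity
    have : ((2 ^ n * D (tab σ.length) σ / 2 ^ T σ : ℕ) : ℝ) / 2 ^ n - bet ℓ b C σ =
        (((2 ^ n * D (tab σ.length) σ / 2 ^ T σ : ℕ) : ℝ) - bet ℓ b C σ * 2 ^ n) / 2 ^ n := by
      field_simp
    rw [this, abs_div, abs_of_pos h2n, inv_pow, div_le_iff₀ h2n, inv_mul_cancel₀ h2n.ne']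
    exact hfl

/-- Each selected event containing `X` eventually turns its stake `2 ^ (-ℓ i)` into capital `1` and
keeps it, so infinitely many of them make the capital tend to infinity. -/
theorem succeeds_bet (hsum : Summable (stake ℓ b)) (C : ℝ≥0) {X : Cantor}
    (hX : {i | b i = true ∧ X ∈ ev i (ℓ i)}.Infinite) : Succeeds (bet ℓ b C) X := by
  have htend : Filter.Tendsto (fun n => (bet ℓ b C (initSeg X n) : ℝ≥0∞)) Filter.atTop
      (nhds ⊤) := by
    rw [ENNReal.tendsto_nhds_top_iff_nat]
    intro M
    obtain ⟨s, hs, hcard⟩ := hX.exists_subset_card_eq (M + 1)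
    filter_upwards [Filter.eventually_ge_atTop (s.sup fun i => Nat.pair i (ℓ i))] with n hn
    have h1 : ((M + 1 : ℕ) : ℝ≥0) ≤ bet ℓ b C (initSeg X n) := by
      refine le_trans ?_ (le_add_of_nonneg_left zero_le)
      refine le_trans (le_of_eq ?_)
        ((summable_stake_mul_capital ℓ b hsum (initSeg X n)).sum_le_tsum s fun _ _ => zero_le)
      rw [Finset.sum_congr rfl (g := fun _ => 1)]
      · simp [hcard]
      · intro i hi
        obtain ⟨hbi, hXi⟩ := hs hi
        have h2 : Nat.pair i (ℓ i) ≤ n :=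
          (Finset.le_sup (f := fun i => Nat.pair i (ℓ i)) hi).trans hn
        rw [capital_eq_two_pow hXi h2, stake, if_pos hbi]
        push_cast
        rw [← mul_pow, inv_mul_cancel₀ two_ne_zero, one_pow]
    calc (M : ℝ≥0∞) < ((M + 1 : ℕ) : ℝ≥0∞) := by exact_mod_cast Nat.lt_succ_self M
      _ ≤ _ := by exact_mod_cast h1
  exact htend.limsup_eq

theorem finite_ev_of_mem_CR {O : Set (ℕ →. ℕ)} (hℓ : Primrec ℓ) (hb : ComputableIn O b)
    (hsum : Summable (stake ℓ b)) {X : Cantor} (hX : X ∈ CR O) :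
    {i | b i = true ∧ X ∈ ev i (ℓ i)}.Finite := by
  by_contra h
  exact hX _ (isMartingale_bet ℓ b hsum _)
    (computableReal_bet ℓ b hℓ hb hsum (Nat.le_ceil _)) (succeeds_bet ℓ b hsum _ h)

end BettingMartingale

/-! ### Baire category, near-coverage and the summable c.e. cover -/

section Covering

open MeasureTheory Topology

theorem exists_cylinder_subset {G : Set Cantor} (hG : IsOpen G) {X : Cantor} (hX : X ∈ G) :
    ∃ k, cylinder (initSeg X k) ⊆ G := by
  obtain ⟨I, u, hu, hsub⟩ := isOpen_pi_iff.1 hG X hX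
  refine ⟨I.sup id + 1, fun Y hY => hsub fun i hi => ?_⟩
  have hi' : i < I.sup id + 1 := Nat.lt_succ_of_le (Finset.le_sup (f := id) hi)
  have h := congrArg (·[i]?) (cylinder_eq_initSeg.1 hY)
  simp only [getElem?_initSeg, if_pos hi', Option.some.injEq] at h
  rw [h]
  exact (hu i hi).2

theorem capital_initSeg_ne_zero_iff {i l n : ℕ} {X : Cantor} :
    capital i l (initSeg X n) ≠ 0 ↔ ∀ j < l, Nat.pair i j < n → X (Nat.pair i j) = true := by
  rw [capital, Finset.prod_ne_zero_iff]
  refine forall_congr' fun j => ?_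
  rw [Finset.mem_range, getElem?_initSeg]
  refine imp_congr_right fun _ => ?_
  by_cases h : Nat.pair i j < n
  · cases hX : X (Nat.pair i j) <;> simp [h, gain]
  · simp [h, gain]

theorem measurableSet_initSeg_mem (n : ℕ) (p : List Bool → Prop) :
    MeasurableSet {X | p (initSeg X n)} := by
  have : {X | p (initSeg X n)} = openOf fun ρ => ρ.length = n ∧ p ρ := by
    ext X
    constructor
    · intro h
      exact ⟨n, length_initSeg X n, h⟩
    · rintro ⟨k, hk, h⟩
      rw [length_initSeg] at hk
      rwa [hk] at h
  rw [this]
  exact measurableSet_openOf _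

/-- A Baire category argument in the support of the measure restricted to `Vᶜ`: if no sequence
outside of the open set `V` lies in infinitely many of the open sets `E i` with `p i`, then on some
cylinder that `V` does not cover, almost all of these `E i` are covered by `V` up to a null set. -/
theorem exists_cylinder_ae_disjoint {V : Set Cantor} (hV : IsOpen V) (hμ : uniformMeasure V < 1)
    {E : ℕ → Set Cantor} (hE : ∀ i, IsOpen (E i)) {p : ℕ → Prop}
    (hfin : ∀ X ∉ V, {i | p i ∧ X ∈ E i}.Finite) :
    ∃ σ : List Bool, ∃ m, 0 < uniformMeasure (cylinder σ \ V) ∧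
      ∀ i ≥ m, p i → uniformMeasure ((E i ∩ cylinder σ) \ V) = 0 := by
  set ν := uniformMeasure.restrict Vᶜ with hν
  set K := ν.support with hK
  have hKc : IsClosed K := Measure.isClosed_support
  have hν0 : ν ≠ 0 := by
    intro h
    have h1 : ν Set.univ = 0 := by rw [h]; rfl
    rw [hν, Measure.restrict_apply_univ, prob_compl_eq_zero_iff hV.measurableSet] at h1
    exact hμ.ne h1
  have hKV : ∀ X ∈ K, X ∉ V := by
    intro X hX hXV
    rw [hK, Measure.mem_support_iff_forall] at hX
    have := hX V (hV.mem_nhds hXV)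
    rw [hν, Measure.restrict_apply hV.measurableSet, Set.inter_compl_self, measure_empty] at this
    exact lt_irrefl _ this
  have : Nonempty K := (Measure.nonempty_support hν0).to_subtype
  have : CompactSpace K := isCompact_iff_compactSpace.1 hKc.isCompact
  -- By `hfin` these closed sets exhaust the compact space `K`, so one of them has interior.
  let F : ℕ → Set K := fun m => {x | ∀ i ≥ m, p i → (x : Cantor) ∉ E i}
  have hF : ∀ m, IsClosed (F m) := by
    intro m
    have : F m = ⋂ i, ⋂ (_ : m ≤ i), ⋂ (_ : p i), (Subtype.val ⁻¹' E i)ᶜ := by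
      ext x
      simp [F]
    rw [this]
    exact isClosed_iInter fun i => isClosed_iInter fun _ => isClosed_iInter fun _ =>
      ((hE i).preimage continuous_subtype_val).isClosed_compl
  have hU : ⋃ m, F m = Set.univ := by
    refine Set.eq_univ_of_forall fun x => Set.mem_iUnion.2 ?_
    obtain ⟨B, hB⟩ := (hfin x (hKV x x.2)).bddAbove
    refine ⟨B + 1, fun i hi hpi hxi => ?_⟩
    have := hB ⟨hpi, hxi⟩
    omega
  obtain ⟨m, x, hx⟩ := nonempty_interior_of_iUnion_of_closed hF hU
  obtain ⟨G, hG, hGx⟩ := isOpen_induced_iff.1 (isOpen_interior (s := F m))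
  have hxG : (x : Cantor) ∈ G := by
    have : x ∈ Subtype.val ⁻¹' G := by rw [hGx]; exact hx
    exact this
  obtain ⟨k, hk⟩ := exists_cylinder_subset hG hxG
  refine ⟨initSeg x k, m, ?_, fun i hi hpi => ?_⟩
  · have h1 := (Measure.mem_support_iff_forall _).1 x.2 (cylinder (initSeg x k))
      ((isOpen_cylinder _).mem_nhds (mem_cylinder_initSeg _ _))
    rwa [hν, Measure.restrict_apply (measurableSet_cylinder _), ← Set.sdiff_eq] at h1
  -- On this cylinder every point of `K` avoids `E i`, and the complement of the support is null for
  -- the restricted measure.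
  · have hsub : E i ∩ cylinder (initSeg x k) ⊆ Kᶜ := by
      rintro Y ⟨hYE, hYc⟩ hYK
      have h1 : (⟨Y, hYK⟩ : K) ∈ interior (F m) := by
        rw [← hGx]
        exact hk hYc
      exact interior_subset h1 i hi hpi hYE
    have h2 : ν (E i ∩ cylinder (initSeg x k)) = 0 :=
      measure_mono_null hsub Measure.measure_compl_support
    rwa [hν, Measure.restrict_apply ((hE i).measurableSet.inter (measurableSet_cylinder _)),
      ← Set.sdiff_eq] at h2

/-- The strings that extend `σ`, are compatible with `ev i (ℓ i)` and have no prefix in `Q`. -/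
def Uncovered (Q : List Bool → Prop) (ℓ : ℕ → ℕ) (σ : List Bool) (i : ℕ) (ρ : List Bool) : Prop :=
  ρ.take σ.length = σ ∧ capital i (ℓ i) ρ ≠ 0 ∧ ¬ ∃ k < ρ.length + 1, Q (ρ.take k)

theorem primrecRel_uncovered {Q : List Bool → Prop} (hQ : PrimrecPred Q) {ℓ : ℕ → ℕ}
    (hℓ : Primrec ℓ) (σ : List Bool) : PrimrecRel (Uncovered Q ℓ σ) := by
  refine (Primrec.eq.comp (Primrec.list_take.comp (Primrec.const _) Primrec.snd)
    (Primrec.const _)).and ((Primrec.eq.comp (primrec_capital hℓ) (Primrec.const 0)).not.and ?_)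
  refine (primrecPred_exists_lt (α := ℕ × List Bool) (p := fun q k => Q (q.2.take k))
    (n := fun q => q.2.length + 1) ?_
    (Primrec.succ.comp (Primrec.list_length.comp Primrec.snd))).not
  exact hQ.comp (Primrec.list_take.comp Primrec.snd (Primrec.snd.comp Primrec.fst))

theorem uncovered_initSeg_iff {Q : List Bool → Prop} {ℓ : ℕ → ℕ} {σ : List Bool} {i n : ℕ}
    (hn : σ.length ≤ n) {X : Cantor} : Uncovered Q ℓ σ i (initSeg X n) ↔ X ∈ cylinder σ ∧
      (∀ j < ℓ i, Nat.pair i j < n → X (Nat.pair i j) = true) ∧ ∀ k ≤ n, ¬ Q (initSeg X k) := by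
  rw [Uncovered, take_initSeg X hn, ← mem_cylinder, capital_initSeg_ne_zero_iff, length_initSeg]
  refine and_congr_right fun _ => and_congr_right fun _ => ?_
  constructor
  · intro h k hk hQ
    exact h ⟨k, by omega, by rwa [take_initSeg X hk]⟩
  · rintro h ⟨k, hk, hQ⟩
    rw [take_initSeg X (by omega)] at hQ
    exact h k (by omega) hQ

/-- Continuity from above along the stages. It makes near-coverage of a fully covered event visible
at a finite stage. -/
theorem tendsto_uncovered (Q : List Bool → Prop) (ℓ : ℕ → ℕ) (σ : List Bool) (i : ℕ) :
    Filter.Tendsto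
      (fun n => uniformMeasure {X | Uncovered Q ℓ σ i (initSeg X (σ.length + n))}) Filter.atTop
      (𝓝 (uniformMeasure ((ev i (ℓ i) ∩ cylinder σ) \ openOf Q))) := by
  have h1 : (ev i (ℓ i) ∩ cylinder σ) \ openOf Q =
      ⋂ n, {X | Uncovered Q ℓ σ i (initSeg X (σ.length + n))} := by
    ext X
    simp only [Set.mem_iInter, Set.mem_ofPred_eq, uncovered_initSeg_iff (Nat.le_add_right _ _)]
    constructor
    · rintro ⟨⟨h1, h2⟩, h3⟩ n
      exact ⟨h2, fun j hj _ => h1 j hj, fun k _ hk => h3 ⟨k, hk⟩⟩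
    · intro h
      refine ⟨⟨fun j hj => (h (Nat.pair i j + 1)).2.1 j hj (by omega), (h 0).1⟩, ?_⟩
      rintro ⟨k, hk⟩
      exact (h k).2.2 k (by omega) hk
  rw [h1]
  refine tendsto_measure_iInter_atTop
    (fun n => (measurableSet_initSeg_mem _ _).nullMeasurableSet) ?_ ⟨0, measure_ne_top _ _⟩
  intro m n hmn X hX
  simp only [Set.mem_ofPred_eq, uncovered_initSeg_iff (Nat.le_add_right _ _)] at hX ⊢
  exact ⟨hX.1, fun j hj hjm => hX.2.1 j hj (by omega), fun k hk => hX.2.2 k (by omega)⟩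

open Classical in
/-- At stage `n` it is visible that `openOf Q` covers `ev i (ℓ i) ∩ [σ]` up to measure
`2 ^ (-(i + D))`. -/
def Covered (Q : List Bool → Prop) (ℓ : ℕ → ℕ) (σ : List Bool) (D i n : ℕ) : Prop :=
  (σ.length ≤ i ∧ σ.length ≤ n) ∧
    ((allStrings n).filter fun ρ => Uncovered Q ℓ σ i ρ).length * 2 ^ (i + D) ≤ 2 ^ n

theorem primrecRel_covered {Q : List Bool → Prop} (hQ : PrimrecPred Q) {ℓ : ℕ → ℕ}
    (hℓ : Primrec ℓ) (σ : List Bool) (D : ℕ) : PrimrecRel (Covered Q ℓ σ D) := by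
  classical
  have h1 : Primrec fun q : ℕ × ℕ =>
      ((allStrings q.2).filter fun ρ => Uncovered Q ℓ σ q.1 ρ).length :=
    primrec_countP (p := fun (q : ℕ × ℕ) ρ => Uncovered Q ℓ σ q.1 ρ)
      ((primrecRel_uncovered hQ hℓ σ).comp (Primrec.fst.comp Primrec.fst) Primrec.snd)
      (primrec_allStrings.comp Primrec.snd)
  refine ((Primrec.nat_le.comp (Primrec.const _) Primrec.fst).and
    (Primrec.nat_le.comp (Primrec.const _) Primrec.snd)).and ?_
  exact (Primrec.nat_le.comp (Primrec.nat_mul.comp h1 (primrec_nat_pow.comp (Primrec.const 2)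
    (Primrec.nat_add.comp Primrec.fst (Primrec.const D))))
    (primrec_nat_pow.comp (Primrec.const 2) Primrec.snd)).of_eq fun q => by
      congr!

theorem covered_iff {Q : List Bool → Prop} {ℓ : ℕ → ℕ} {σ : List Bool} {D i n : ℕ} :
    Covered Q ℓ σ D i n ↔ (σ.length ≤ i ∧ σ.length ≤ n) ∧
      uniformMeasure {X | Uncovered Q ℓ σ i (initSeg X n)} ≤ (2 : ℝ≥0∞)⁻¹ ^ (i + D) := by
  classical
  rw [uniformMeasure_initSeg_mem, count_mul_le_iff, Covered]

theorem uniformMeasure_diff_le_of_covered {Q : List Bool → Prop} {ℓ : ℕ → ℕ} {σ : List Bool}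
    {D i n : ℕ} (h : Covered Q ℓ σ D i n) :
    uniformMeasure ((ev i (ℓ i) ∩ cylinder σ) \ openOf Q) ≤ (2 : ℝ≥0∞)⁻¹ ^ (i + D) := by
  rw [covered_iff] at h
  refine (measure_mono fun X hX => ?_).trans h.2
  rw [Set.mem_ofPred_eq, uncovered_initSeg_iff h.1.2]
  exact ⟨hX.1.2, fun j hj _ => hX.1.1 j hj, fun k _ hk => hX.2 ⟨k, hk⟩⟩

theorem exists_covered {Q : List Bool → Prop} {ℓ : ℕ → ℕ} {σ : List Bool} (D : ℕ) {i : ℕ}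
    (hi : σ.length ≤ i) (h : uniformMeasure ((ev i (ℓ i) ∩ cylinder σ) \ openOf Q) = 0) :
    ∃ n, Covered Q ℓ σ D i n := by
  have h1 := tendsto_uncovered Q ℓ σ i
  rw [h] at h1
  have h2 : (0 : ℝ≥0∞) < 2⁻¹ ^ (i + D) := ENNReal.pow_pos (by simp) _
  obtain ⟨n, hn⟩ := (h1.eventually (gt_mem_nhds h2)).exists
  exact ⟨σ.length + n, covered_iff.2 ⟨⟨hi, by omega⟩, hn.le⟩⟩

open Classical in
-- A quantitative second Borel–Cantelli argument. Up to a total error of `δ / 2`, the set `[σ] \ V`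
-- avoids every covered event. For finitely many such events independence gives `δ / 2 ≤ ∏ (1 - 2 ^
-- (-ℓ i)) ≤ exp (-∑ 2 ^ (-ℓ i))`, which bounds all partial sums.
theorem summable_covered {Q : List Bool → Prop} (ℓ : ℕ → ℕ) {σ : List Bool}
    (hσ : 0 < uniformMeasure (cylinder σ \ openOf Q)) :
    ∃ D, Summable (stake ℓ fun i => decide (∃ n, Covered Q ℓ σ D i n)) := by
  set δ := uniformMeasure.real (cylinder σ \ openOf Q) with hδ
  have hδ0 : 0 < δ := ENNReal.toReal_pos hσ.ne' (measure_ne_top _ _)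
  -- The errors `2 ^ (-(i + D))` sum to at most `2 * 2 ^ (-D)`, which is below `δ / 2`.
  obtain ⟨D, hD⟩ := exists_pow_lt_of_lt_one (show 0 < δ / 4 by positivity)
    (show (2⁻¹ : ℝ) < 1 by norm_num)
  refine ⟨D, ?_⟩
  rw [← NNReal.summable_coe]
  refine summable_of_sum_le (c := -Real.log (δ / 2)) (fun i => NNReal.coe_nonneg _) fun u => ?_
  set s := u.filter fun i => ∃ n, Covered Q ℓ σ D i n with hs
  have h1 : ∑ i ∈ u, (stake ℓ (fun i => decide (∃ n, Covered Q ℓ σ D i n)) i : ℝ) =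
      ∑ i ∈ s, (2⁻¹ : ℝ) ^ ℓ i := by
    rw [hs, Finset.sum_filter]
    refine Finset.sum_congr rfl fun i _ => ?_
    by_cases h : ∃ n, Covered Q ℓ σ D i n <;> simp [stake, h]
  have hcov : ∀ i ∈ s, ∃ n, Covered Q ℓ σ D i n := fun i hi => (Finset.mem_filter.1 hi).2
  have hsub : cylinder σ \ openOf Q ⊆ (cylinder σ ∩ ⋂ i ∈ s, (ev i (ℓ i))ᶜ) ∪
      ⋃ i ∈ s, (ev i (ℓ i) ∩ cylinder σ) \ openOf Q := by
    intro X hX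
    by_cases h : ∃ i ∈ s, X ∈ ev i (ℓ i)
    · obtain ⟨i, hi, hXi⟩ := h
      exact Or.inr (Set.mem_biUnion (x := i) hi ⟨⟨hXi, hX.1⟩, hX.2⟩)
    · refine Or.inl ⟨hX.1, Set.mem_iInter₂.2 fun i hi hXi => h ⟨i, hi, hXi⟩⟩
  have hprod0 : ∀ i ∈ s, (0 : ℝ) ≤ 1 - 2⁻¹ ^ ℓ i := fun i _ =>
    sub_nonneg.2 (pow_le_one₀ (by norm_num) (by norm_num))
  have h2 : δ ≤ ∏ i ∈ s, (1 - (2⁻¹ : ℝ) ^ ℓ i) + δ / 2 := by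
    refine (measureReal_mono hsub).trans ((measureReal_union_le _ _).trans (add_le_add ?_ ?_))
    -- The clause `|σ| ≤ i` in `Covered` ensures that the events are independent of `[σ]`.
    · rw [measureReal_cylinder_inter_compl_ev ℓ s σ fun i hi => (hcov i hi).choose_spec.1.1]
      exact mul_le_of_le_one_left (Finset.prod_nonneg hprod0)
        (pow_le_one₀ (by norm_num) (by norm_num))
    · refine (measureReal_biUnion_finset_le _ _).trans ?_
      calc _ ≤ ∑ i ∈ s, (1 / 2 : ℝ) ^ i * 2⁻¹ ^ D := by
            refine Finset.sum_le_sum fun i hi => ?_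
            obtain ⟨n, hn⟩ := hcov i hi
            have := ENNReal.toReal_mono (by simp) (uniformMeasure_diff_le_of_covered hn)
            refine this.trans (le_of_eq ?_)
            simp [pow_add]
        _ = (∑ i ∈ s, (1 / 2 : ℝ) ^ i) * 2⁻¹ ^ D := by rw [Finset.sum_mul]
        _ ≤ 2 * 2⁻¹ ^ D := by
            refine mul_le_mul_of_nonneg_right ?_ (by positivity)
            exact (summable_geometric_two.sum_le_tsum s fun _ _ => by positivity).trans
              tsum_geometric_two.le
        _ ≤ δ / 2 := by linarith
  have h3 : ∏ i ∈ s, (1 - (2⁻¹ : ℝ) ^ ℓ i) ≤ Real.exp (-∑ i ∈ s, (2⁻¹ : ℝ) ^ ℓ i) := by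
    rw [← Finset.sum_neg_distrib, Real.exp_sum]
    exact Finset.prod_le_prod hprod0 fun i _ => Real.one_sub_le_exp_neg _
  have h4 : δ / 2 ≤ Real.exp (-∑ i ∈ s, (2⁻¹ : ℝ) ^ ℓ i) := by linarith
  have h5 := (Real.log_le_iff_le_exp (by positivity)).2 h4
  rw [h1]
  linarith

open Classical in
/-- If every random sequence is computably random relative to `O`, then a summable family of
weights whose support is decidable relative to `O` is essentially contained in a summable
computably enumerable one. -/
theorem exists_summable_cover {O : Set (ℕ →. ℕ)} (hO : MLR ∅ ⊆ CR O) {ℓ : ℕ → ℕ}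
    (hℓ : Primrec ℓ) {b : ℕ → Bool} (hb : ComputableIn O b) (hsum : Summable (stake ℓ b)) :
    ∃ S : ℕ → ℕ → Prop, PrimrecRel S ∧ (∃ m, ∀ i ≥ m, b i = true → ∃ n, S i n) ∧
      Summable (stake ℓ fun i => decide (∃ n, S i n)) := by
  obtain ⟨σ, m, hσ, hm⟩ := exists_cylinder_ae_disjoint (isOpen_openOf UniversalPred)
    (uniformMeasure_openOf_universalPred_le.trans_lt ENNReal.one_half_lt_one)
    (fun i => isOpen_ev i (ℓ i)) (p := fun i => b i = true) fun X hX =>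
      finite_ev_of_mem_CR ℓ b hℓ hb hsum
        (hO (by_contra fun h => hX (mem_openOf_universalPred_of_notMem_MLR h)))
  obtain ⟨D, hD⟩ := summable_covered ℓ hσ
  exact ⟨Covered UniversalPred ℓ σ D, primrecRel_covered primrecPred_universalPred hℓ σ D,
    ⟨max m σ.length, fun i hi hbi => exists_covered D (le_of_max_le_right hi)
      (hm i (le_of_max_le_left hi) hbi)⟩, hD⟩

theorem summable_stake_iff (ℓ : ℕ → ℕ) (b : ℕ → Bool) :
    Summable (stake ℓ b) ↔ ∑' i : {i // b i = true}, (2 : ℝ≥0∞)⁻¹ ^ ℓ i ≠ ⊤ := by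
  have h := tsum_subtype {i | b i = true} fun i => (2 : ℝ≥0∞)⁻¹ ^ ℓ i
  rw [← ENNReal.tsum_coe_ne_top_iff_summable]
  refine not_congr (Eq.congr_left ((tsum_congr fun i => ?_).trans h.symm))
  by_cases h : b i = true <;> simp [stake, h, ENNReal.inv_pow]

theorem MLR_subset_MLR_of_subset_CR {O : Set (ℕ →. ℕ)} (hO : MLR ∅ ⊆ CR O) : MLR ∅ ⊆ MLR O := by
  classical
  intro X
  contrapose
  intro hX
  obtain ⟨r, hr, hsum, hpre⟩ := exists_solovay_of_notMem_MLR hX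
  have hℓ : Primrec fun i => (str i).length := Primrec.list_length.comp primrec_str
  -- Indices that decode to nothing are sent to the empty string by `str`; requiring `i` to be the
  -- code of its string keeps one index per string, so weights are not counted repeatedly.
  have hb : ComputableIn O fun i => r (str i) && decide (Encodable.encode (str i) = i) := by
    have h1 : Primrec fun q : Bool × ℕ => q.1 && decide (Encodable.encode (str q.2) = q.2) :=
      Primrec.and.comp Primrec.fst (Primrec.eq.comp (Primrec.encode.comp
        (primrec_str.comp Primrec.snd)) Primrec.snd).decide
    exact primrec_comp_computableIn (g := fun i => (r (str i), i)) h1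
      (computableIn_pair (computableIn_comp_primrec hr primrec_str) ComputableIn.id)
  set b : ℕ → Bool := fun i => r (str i) && decide (Encodable.encode (str i) = i) with hbdef
  have hb' : ∀ i, b i = true ↔ r (str i) = true ∧ Encodable.encode (str i) = i := fun i => by
    simp [hbdef]
  have hs : Summable (stake (fun i => (str i).length) b) := by
    rw [summable_stake_iff]
    have hinj : Function.Injective fun i : {i // b i = true} =>
        (⟨str i, ((hb' i).1 i.2).1⟩ : {σ // r σ = true}) := by
      intro i j hij
      have h := congrArg Encodable.encode (Subtype.ext_iff.1 hij)
      rw [((hb' i).1 i.2).2, ((hb' j).1 j.2).2] at h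
      exact Subtype.ext h
    exact ne_top_of_le_ne_top hsum (ENNReal.tsum_comp_le_tsum_of_injective hinj
      fun σ : {σ // r σ = true} => weight σ)
  obtain ⟨S, hS, ⟨m, hm⟩, hSsum⟩ := exists_summable_cover hO hℓ hb hs
  rw [summable_stake_iff] at hSsum
  refine notMem_MLR_of_solovay (S := fun σ n => S (Encodable.encode σ) n)
    (hS.comp (Primrec.encode.comp Primrec.fst) Primrec.snd) ?_ fun k => ?_
  · have hinj : Function.Injective fun σ : {σ : List Bool // ∃ n, S (Encodable.encode σ) n} =>
        (⟨Encodable.encode σ.1, decide_eq_true σ.2⟩ : {i // decide (∃ n, S i n) = true}) :=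
      fun σ τ h => Subtype.ext (Encodable.encode_injective (Subtype.ext_iff.1 h))
    refine ne_top_of_le_ne_top hSsum (le_trans (le_of_eq (tsum_congr fun σ => ?_))
      (ENNReal.tsum_comp_le_tsum_of_injective hinj _))
    simp [weight]
  · obtain ⟨j, hj, hrj⟩ := hpre (max k (m + 1))
    refine ⟨j, le_of_max_le_left hj, hm _ ?_ ((hb' _).2 (by simpa using hrj))⟩
    -- The code of a string is at least its length, so long prefixes of `X` have indices beyond the
    -- exceptional bound `m`.
    have h1 : (initSeg X j).length ≤ Encodable.encode (initSeg X j) := Encodable.length_le_encode _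
    rw [length_initSeg] at h1
    exact (le_of_max_le_right hj).trans h1 |>.trans' (Nat.le_succ m)

end Covering

end AlgRandom

theorem mainTheorem3 :
    AlgRandom.Low AlgRandom.MLR = AlgRandom.LowPair AlgRandom.MLR AlgRandom.CR := by
  ext A
  constructor
  · intro h
    exact (Eq.symm h).subset.trans (AlgRandom.MLR_subset_CR _)
  · intro h
    exact (AlgRandom.MLR_anti (Set.empty_subset _)).antisymm
      (AlgRandom.MLR_subset_MLR_of_subset_CR h)
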